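/- Let $(\mathcal A,\phi)$ be a non-commutative C$^*$-probability space: a unital C$^*$-algebra $\mathcal A$ with a positive, linear, unital $\phi:\mathcal A\to\mathbb C$. The free cumulants $\kappa_n:\mathcal A^n\to\mathbb C$ are defined recursively by $$\phi(X_1\cdots X_n)=\sum_{\pi\in NC(n)}\ \prod_{\substack{B\in\pi\\ B=\{b(1)<\dots<b(s)\}}}\kappa_s(X_{b(1)},\dots,X_{b(s)}),$$ where $NC(n)$ is the set of non-crossing partitions of $\{1,\dots,n\}$. A selfadjoint $x\in\mathcal A$ is semicircular of mean $0$ if $\kappa_n(x,\dots,x)=\delta_{n,2}\sigma^2$ for all $n\ge1$ and some $\sigma\ge 0$. A family of elements is free if the unital subalgebras that they generate are free: $\phi(a_1\cdots a_n)=0$ for $n\ge1$ whenever $\phi(a_j)=0$ for all $j$ and $a_j,a_{j+1}$ come from different subalgebras of the family for all $j<n$. Let $\mathcal H$ be a complex Hilbert space and, for $N\ge1$ and $f\in\mathcal H$, let $S_N(f)=[c_{i,j}(f)]_{i,j=1}^N\in M_N(\mathcal A)$ be such that (i) $\phi(c_{i,j}(f)\,c_{k,l}(g))=\frac1N\,\delta_{i,l}\,\delta_{j,k}\,\langle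 f,g\rangle$ for all $f,g\in\mathcal H$ (inner product conjugate-linear in the first variable); (ii) $S_N(f)^*=S_N(f)$; (iii) for every set $s$ of pairwise orthogonal vectors of $\mathcal H$, $\{\Re c_{i,j}(f),\Im c_{i,j}(f): f\in s,\ 1\le i\le j\le N\}$ is a free family of semicircular elements of mean $0$. Let $(f_\alpha)_{\alpha\in I}$ be an orthonormal family in $\mathcal H$, let $r\ge3$, $l_1,\dots,l_r\ge 1$, $M(0)=0$, $M(k)=l_1+\dots+l_k$, $M=M(r)$, and let $i_1,\dots,i_M\in I$. Let $A_1^{(N)},\dots,A_M^{(N)}\in M_N(\mathbb C)$, $N\ge1$, be constant matrices with a limit distribution: for all $n$ and all $p_1,\dots,p_n\in\{1,\dots,M\}$ the limit $\lim_{N\to\infty}\frac1N\operatorname{Tr}(A^{(N)}_{p_1}\cdots A^{(N)}_{p_n})$ exists and is finite. For $k=1,\dots,r$ put $$Y_k^{(N)}=S_N\big(f_{i_{M(k-1)+1}}\big)A^{(N)}_{M(k-1)+1}\cdots S_N\big(f_{i_{M(k)}}\big)A^{(N)}_{M(k)} .$$ Then, with $\operatorname{Tr}$ the unnormalized trace,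 $$\lim_{N\to\infty}\kappa_r\big(\operatorname{Tr}(Y_1^{(N)}),\dots,\operatorname{Tr}(Y_r^{(N)})\big)=0,$$ and moreover $\kappa_r\big(\operatorname{Tr}(Y_1^{(N)}),\dots,\operatorname{Tr}(Y_r^{(N)})\big)=O(N^{-1})$ as $N\to\infty$. -/

import Mathlib

open Filter Topology Asymptotics
open scoped ComplexOrder ComplexStarModule

noncomputable section

namespace FreeProb

/-- A state on a unital complex star-algebra: a positive, linear, unital functional. A C*-algebra with
such a functional is a non-commutative C*-probability space. -/
structure IsState {A : Type*} [CStarAlgebra A] (φ : A →ₗ[ℂ] ℂ) : Prop where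
  map_one : φ 1 = 1
  nonneg : ∀ a : A, 0 ≤ φ (star a * a)

/-- A partition of `{0, …, n-1}` is non-crossing if no two distinct blocks `B`, `D` contain
`i < j < k < l` with `i, k ∈ B` and `j, l ∈ D`. -/
def IsNonCrossing {n : ℕ} (π : Finpartition (Finset.univ : Finset (Fin n))) : Prop :=
  ∀ B ∈ π.parts, ∀ D ∈ π.parts, B ≠ D →
    ¬ ∃ i j k l : Fin n, i < j ∧ j < k ∧ k < l ∧ i ∈ B ∧ k ∈ B ∧ j ∈ D ∧ l ∈ D

open Classical in
/-- The set `NC(n)` of non-crossing partitions. -/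
def NC (n : ℕ) : Finset (Finpartition (Finset.univ : Finset (Fin n))) :=
  Finset.univ.filter IsNonCrossing

/-- The tuple `(X_{b(1)}, …, X_{b(s)})` for a block `B = {b(1) < ⋯ < b(s)}`. -/
def restrictTo {A : Type*} {n : ℕ} (X : Fin n → A) (B : Finset (Fin n)) : Fin B.card → A :=
  fun j => X (B.orderEmbOfFin rfl j)

open Classical in
/-- The free cumulant `κ_n(X_1, …, X_n)`: the moment-cumulant recurrence
`φ(X_1 ⋯ X_n) = ∑_{π ∈ NC(n)} ∏_{B ∈ π} κ_{|B|}(X|_B)`, solved for the term of the one-block partition.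
In the sum below no block is the whole set, so the guard `B.card < n` always holds
(see `moment_eq_sum_freeCumulant`). -/
def freeCumulant {A : Type*} [CStarAlgebra A] (φ : A →ₗ[ℂ] ℂ) (n : ℕ) (X : Fin n → A) : ℂ :=
  φ (List.ofFn X).prod -
    ∑ π ∈ (NC n).filter (fun π => Finset.univ ∉ π.parts),
      ∏ B ∈ π.parts,
        if _h : B.card < n then freeCumulant φ B.card (restrictTo X B) else 0
  termination_by n

/-- Free independence of a family of unital subalgebras: `φ(a_0 a_1 ⋯ a_n) = 0` for centred
`a_j` from the algebras, neighbouring ones from different algebras. -/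
def IsFreeFamily {A ι : Type*} [CStarAlgebra A] (φ : A →ₗ[ℂ] ℂ) (B : ι → Subalgebra ℂ A) : Prop :=
  ∀ (n : ℕ) (ε : Fin (n + 1) → ι) (a : Fin (n + 1) → A),
    (∀ j, a j ∈ B (ε j)) → (∀ j, φ (a j) = 0) →
    (∀ j : Fin n, ε j.castSucc ≠ ε j.succ) →
    φ (List.ofFn a).prod = 0

/-- A semicircular element of mean `0` and variance `σ²`; the degenerate variance `0` is allowed
(the imaginary part of a diagonal entry of a selfadjoint matrix is `0`). -/
def IsSemicircular {A : Type*} [CStarAlgebra A] (φ : A →ₗ[ℂ] ℂ) (x : A) : Prop :=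
  IsSelfAdjoint x ∧ ∃ σ : ℝ, 0 ≤ σ ∧ ∀ n : ℕ, 1 ≤ n →
    freeCumulant φ n (fun _ => x) = if n = 2 then (σ : ℂ) ^ 2 else 0

/-- A free family of centred semicircular elements (free independence of elements means that of
the unital subalgebras they generate). -/
def IsFreeSemicircularFamily {A ι : Type*} [CStarAlgebra A] (φ : A →ₗ[ℂ] ℂ) (x : ι → A) : Prop :=
  (∀ i, IsSemicircular φ (x i)) ∧ IsFreeFamily φ (fun i => Algebra.adjoin ℂ {x i})

/-- The real part (`true`) or the imaginary part (`false`) of an element. -/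
def reIm {A : Type*} [CStarAlgebra A] (b : Bool) (a : A) : A :=
  if b then (ℜ a : A) else (ℑ a : A)

/-- The ensemble `S_N(f) = [c_{i,j}(f)]` of semicircular random matrices over a Hilbert space. -/
structure IsSemicircularEnsemble {A E : Type*} [CStarAlgebra A]
    [NormedAddCommGroup E] [InnerProductSpace ℂ E]
    (φ : A →ₗ[ℂ] ℂ) (S : ∀ N : ℕ, E → Matrix (Fin N) (Fin N) A) : Prop where
  covariance : ∀ (N : ℕ) (f g : E) (i j k l : Fin N),
    φ (S N f i j * S N g k l) = if i = l ∧ j = k then (N : ℂ)⁻¹ * inner ℂ f g else 0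
  selfAdjoint : ∀ (N : ℕ) (f : E), (S N f).conjTranspose = S N f
  /-- The `Re c_{i,j}(f)`, `Im c_{i,j}(f)`, for `i ≤ j` and `f` in a set of pairwise orthogonal
  vectors, are free centred semicircular elements. -/
  free : ∀ (N : ℕ) (s : Set E), s.Pairwise (fun f g => inner ℂ f g = 0) →
    IsFreeSemicircularFamily φ
      (fun q : s × {p : Fin N × Fin N // p.1 ≤ p.2} × Bool =>
        reIm q.2.2 (S N (q.1 : E) q.2.1.1.1 q.2.1.1.2))

/-- An ensemble of constant matrices has a limit distribution if the normalized trace of each word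
in its members converges as `N → ∞`. -/
def HasLimitDistribution {I : Type*} (a : I → ∀ N : ℕ, Matrix (Fin N) (Fin N) ℂ) : Prop :=
  ∀ (n : ℕ) (w : Fin n → I), ∃ c : ℂ,
    Tendsto (fun N : ℕ => (N : ℂ)⁻¹ * (List.ofFn fun j => a (w j) N).prod.trace) atTop (𝓝 c)

/-- A constant matrix, seen as a matrix with entries in `A`. -/
def constMatrix (A : Type*) [CStarAlgebra A] {N : ℕ} (a : Matrix (Fin N) (Fin N) ℂ) :
    Matrix (Fin N) (Fin N) A :=
  a.map (algebraMap ℂ A)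

/-- The alternating product `S_N(f_0) a_0 S_N(f_1) a_1 ⋯ S_N(f_{l-1}) a_{l-1}`. -/
def altProd {A E : Type*} [CStarAlgebra A] {N : ℕ} (S : E → Matrix (Fin N) (Fin N) A)
    {l : ℕ} (f : Fin l → E) (a : Fin l → Matrix (Fin N) (Fin N) ℂ) : Matrix (Fin N) (Fin N) A :=
  (List.ofFn fun t => S (f t) * constMatrix A (a t)).prod

/-- The free moment-cumulant formula. -/
theorem moment_eq_sum_freeCumulant {A : Type*} [CStarAlgebra A] (φ : A →ₗ[ℂ] ℂ)
    {n : ℕ} (hn : 0 < n) (X : Fin n → A) :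
    φ (List.ofFn X).prod =
      ∑ π ∈ NC n, ∏ B ∈ π.parts, freeCumulant φ B.card (restrictTo X B) := by
  classical
  have : Nonempty (Fin n) := ⟨⟨0, hn⟩⟩
  have hne : (Finset.univ : Finset (Fin n)) ≠ ⊥ := Finset.univ_nonempty.ne_empty
  have key : (NC n).filter (fun π => ¬ Finset.univ ∉ π.parts) = {Finpartition.indiscrete hne} := by
    ext π
    simp only [NC, Finset.mem_filter, Finset.mem_univ, true_and, Finset.mem_singleton, not_not]
    constructor
    · rintro ⟨-, h⟩
      ext B
      simp only [Finpartition.indiscrete_parts, Finset.mem_singleton]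
      constructor
      · intro hB
        obtain ⟨b, hb⟩ := π.nonempty_of_mem_parts hB
        exact π.eq_of_mem_parts hB h hb (Finset.mem_univ b)
      · rintro rfl
        exact h
    · rintro rfl
      refine ⟨?_, by simp⟩
      intro B hB D hD hBD
      simp only [Finpartition.indiscrete_parts, Finset.mem_singleton] at hB hD
      exact absurd (hB.trans hD.symm) hBD
  rw [← Finset.sum_filter_add_sum_filter_not (NC n) (fun π => Finset.univ ∉ π.parts), key,
    Finset.sum_singleton, Finpartition.indiscrete_parts, Finset.prod_singleton]
  have h1 : freeCumulant φ (Finset.univ : Finset (Fin n)).card (restrictTo X Finset.univ) =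
      freeCumulant φ n X := by
    have aux : ∀ (m : ℕ) (h : m = n) (Z : Fin m → A), (∀ j, Z j = X (Fin.cast h j)) →
        freeCumulant φ m Z = freeCumulant φ n X := by
      intro m h Z hZ
      subst h
      congr 1
      exact funext hZ
    refine aux _ (Finset.card_fin n) _ fun j => ?_
    have h2 : (Finset.univ : Finset (Fin n)).orderEmbOfFin rfl =
        (Fin.castOrderIso (Finset.card_fin n)).toOrderEmbedding :=
      (Finset.orderEmbOfFin_unique' rfl fun x => Finset.mem_univ _).symm
    simp only [restrictTo, h2]
    rfl
  rw [h1]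
  conv_rhs => rw [freeCumulant]
  have h3 : ∀ π ∈ (NC n).filter (fun π => Finset.univ ∉ π.parts),
      (∏ B ∈ π.parts, if _h : B.card < n then freeCumulant φ B.card (restrictTo X B) else 0) =
        ∏ B ∈ π.parts, freeCumulant φ B.card (restrictTo X B) := by
    intro π hπ
    refine Finset.prod_congr rfl fun B hB => ?_
    have hBu : B ≠ Finset.univ := fun h => (Finset.mem_filter.1 hπ).2 (h ▸ hB)
    have : B.card < n := by
      simpa using Finset.card_lt_univ_of_notMem (s := B)
        (by simpa [Finset.eq_univ_iff_forall] using hBu : ∃ x, x ∉ B).choose_spec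
    rw [dif_pos this]
  rw [Finset.sum_congr rfl h3]
  ring

end FreeProb

end

/-! The cumulant of the traces has a genus expansion in which only connected pairings occur, and
connectedness costs powers of `N`.

Wick formula. The entries of `S N (f i)`, for an orthonormal family `f`, lie in the linear span of a
free semicircular family. The Wick products, `W(a, b, l) = a W(b, l) - φ(ab) W(l)`, are multilinear.
On a free semicircular family they factor along runs of equal letters into alternating products of
centred elements, so freeness makes them centred. Expanding moments in Wick products yields `φ(z₁ ⋯
zₙ)` as the sum over non-crossing pairings of products of covariances
(`IsFreeSemicircularFamily.moment_eq_sum_pairings`).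

Products as arguments. Cut the letters into consecutive blocks. A non-crossing pairing of the
letters joins the blocks into clusters; these form a non-crossing partition of the blocks, and the
pairings with prescribed clusters factor over them. Hence the sums over pairings that connect a set
of blocks obey the moment-cumulant recursion, and they are the free cumulants of the block products
(`blockCumulant_eq_clusterSum`).

Genus bound. By multilinearity and the covariance, `κ_r` is a finite sum over connected pairings `π`
with `m` pairs (`freeCumulant_trace_altProd`). Each term is `N^{-m}`, times inner products
independent of `N`, times a contraction of the constant matrices along the permutation `π γ`, where
`γ` rotates each block. The contraction is a product of one trace per cycle, so it is `O(N^c)` with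
`c` the number of cycles. Connectedness forces `c ≤ m + 2 - r` (`card_cycles_add_le`), so each term
is `O(N^{2-r})`, which is `O(N^{-1})` for `r ≥ 3`. -/

namespace FreeProb

/-! ### Ordered products over finite subsets of a linear order -/

section OrderedProduct

variable {P A : Type*} [LinearOrder P] [Monoid A]

/-- The product of the `z p`, `p ∈ Q`, in increasing order of `p`. -/
def oprod (z : P → A) (Q : Finset P) : A := (Q.sort.map z).prod

@[simp] theorem oprod_empty (z : P → A) : oprod z ∅ = 1 := by simp [oprod]

theorem sort_union {Q R : Finset P} (h : ∀ p ∈ Q, ∀ q ∈ R, p < q) :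
    (Q ∪ R).sort = Q.sort ++ R.sort := by
  have hd : Disjoint Q R :=
    Finset.disjoint_left.2 fun p hp hq => lt_irrefl p (h p hp p hq)
  have hp : ((Q ∪ R).sort).Perm (Q.sort ++ R.sort) := by
    refine (List.perm_ext_iff_of_nodup (Finset.sort_nodup _ _) ?_).2 fun a => by simp
    refine List.Nodup.append (Finset.sort_nodup _ _) (Finset.sort_nodup _ _) ?_
    intro a ha hb
    exact lt_irrefl a (h a (by simpa using ha) a (by simpa using hb))
  refine hp.eq_of_pairwise' (Finset.pairwise_sort _ _) ?_
  refine List.pairwise_append.2 ⟨Finset.pairwise_sort _ _, Finset.pairwise_sort _ _, ?_⟩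
  intro a ha b hb
  exact (h a (by simpa using ha) b (by simpa using hb)).le

theorem oprod_union (z : P → A) {Q R : Finset P} (h : ∀ p ∈ Q, ∀ q ∈ R, p < q) :
    oprod z (Q ∪ R) = oprod z Q * oprod z R := by
  simp [oprod, sort_union h]

theorem oprod_singleton (z : P → A) (p : P) : oprod z {p} = z p := by simp [oprod]

/-- Ordered products over the fibres of a monotone map. -/
theorem oprod_fibres {K : Type*} [LinearOrder K] [Fintype P] (b : P → K) (hb : Monotone b)
    (z : P → A) (B : Finset K) :
    oprod (fun k => oprod z {p | b p = k}) B = oprod z {p | b p ∈ B} := by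
  induction B using Finset.induction_on_max with
  | empty => simp
  | insert k B hk ih =>
    have h1 : (insert k B : Finset K) = B ∪ {k} := by
      rw [Finset.union_comm]; rfl
    have h2 : (Finset.univ.filter fun p => b p ∈ B ∪ {k}) =
        (Finset.univ.filter fun p => b p ∈ B) ∪ Finset.univ.filter fun p => b p = k := by
      ext p; simp [or_comm]
    rw [h1, h2, oprod_union, oprod_union, ih, oprod_singleton]
    · intro p hp q hq
      simp only [Finset.mem_filter, Finset.mem_univ, true_and] at hp hq
      by_contra hqp
      have := hb (not_lt.1 hqp)
      rw [hq] at this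
      exact absurd (hk _ hp) (not_lt.2 this)
    · intro p hp q hq
      rw [Finset.mem_singleton.1 hq]
      exact hk p hp

end OrderedProduct

/-! ### Non-crossing pairings and their recursion -/

section Pairings

variable {P : Type*} [LinearOrder P] [Fintype P]

/-- A non-crossing pairing of `Q`, as an involution whose set of moved points is `Q`. -/
structure IsNCPairing (Q : Finset P) (π : P → P) : Prop where
  invol : ∀ p, π (π p) = p
  supp : ∀ p, π p ≠ p ↔ p ∈ Q
  nc : ∀ p q, p < q → q < π p → ¬ π p < π q

open Classical in
/-- The set of non-crossing pairings of `Q`. -/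
noncomputable def ncPairings (Q : Finset P) : Finset (P → P) := Finset.univ.filter (IsNCPairing Q)

theorem mem_ncPairings {Q : Finset P} {π : P → P} : π ∈ ncPairings Q ↔ IsNCPairing Q π := by
  simp [ncPairings]

omit [Fintype P] in
theorem IsNCPairing.mem {Q : Finset P} {π : P → P} (h : IsNCPairing Q π) {p : P} (hp : p ∈ Q) :
    π p ∈ Q := by
  rw [← h.supp] at hp ⊢
  rw [h.invol]
  exact hp.symm

/-- The product of the covariances over the pairs of a pairing. -/
def pairWeight {A : Type*} [Ring A] [Algebra ℂ A] (φ : A →ₗ[ℂ] ℂ) (z : P → A) (π : P → P) : ℂ :=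
  ∏ p, if p < π p then φ (z p * z (π p)) else 1

variable {A : Type*} [Ring A] [Algebra ℂ A] (φ : A →ₗ[ℂ] ℂ) (z : P → A)

open Classical in
/-- The sum of the weights of the non-crossing pairings of `v ∪ w` that pair no two points of `w`. -/
noncomputable def pairSum (v w : Finset P) : ℂ :=
  ∑ π ∈ (ncPairings (v ∪ w)).filter (fun π => ∀ p ∈ w, π p ∉ w), pairWeight φ z π

theorem pairSum_empty_right (v : Finset P) :
    pairSum φ z v ∅ = ∑ π ∈ ncPairings v, pairWeight φ z π := by
  simp [pairSum]

theorem pairSum_empty_left (w : Finset P) : pairSum φ z ∅ w = if w = ∅ then 1 else 0 := by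
  split_ifs with h
  · subst h
    rw [pairSum_empty_right]
    have : ncPairings (∅ : Finset P) = {id} := by
      ext π
      rw [mem_ncPairings, Finset.mem_singleton]
      constructor
      · intro h
        funext p
        by_contra hp
        simpa using (h.supp p).1 hp
      · rintro rfl
        exact ⟨fun _ => rfl, fun p => by simp, fun p q h1 h2 => by exact fun _ => absurd h1 h2.asymm⟩
    rw [this]
    simp [pairWeight]
  · obtain ⟨p, hp⟩ := Finset.nonempty_iff_ne_empty.2 h
    refine Finset.sum_eq_zero fun π hπ => ?_
    rw [Finset.mem_filter, mem_ncPairings, Finset.empty_union] at hπ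
    exact absurd (hπ.1.mem hp) (hπ.2 p hp)

theorem pairSum_insert_empty (v : Finset P) (i : P) :
    pairSum φ z (insert i v) ∅ = pairSum φ z v {i} := by
  rw [pairSum_empty_right, pairSum]
  have : insert i v = v ∪ {i} := by rw [Finset.union_comm]; rfl
  rw [this]
  refine Finset.sum_congr (Finset.filter_true_of_mem ?_).symm fun _ _ => rfl
  intro π hπ p hp
  rw [mem_ncPairings] at hπ
  rw [Finset.mem_singleton] at hp ⊢
  subst hp
  exact (hπ.supp p).2 (by simp)

/-- Removing the pair `{i, h}` from an involution, or inserting it. -/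
def togglePair (i h : P) (rem : Bool) (π : P → P) : P → P := fun p =>
  if p = i then (if rem then i else h) else if p = h then (if rem then h else i) else π p

theorem pairWeight_toggle {i h : P} (hih : i < h) {π : P → P} (h1 : π i = i) (h2 : π h = h) :
    pairWeight φ z (togglePair i h false π) = φ (z i * z h) * pairWeight φ z π := by
  have key : ∀ p, (if p < togglePair i h false π p then
      φ (z p * z (togglePair i h false π p)) else 1) =
      (if p = i then φ (z i * z h) else 1) * (if p < π p then φ (z p * z (π p)) else 1) := by
    intro p
    unfold togglePair
    by_cases hi : p = i
    · subst hi; simp [h1, hih]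
    · by_cases hh : p = h
      · subst hh; simp [hi, h2, hih.le]
      · simp [hi, hh]
  simp only [pairWeight]
  rw [Finset.prod_congr rfl fun p _ => key p, Finset.prod_mul_distrib]
  simp

/-- Split by the partner of `i`, the last point of the left part. Either it lies in the left part,
and `i` may be moved to the right part; or it is `h`, the only partner on the right compatible with
non-crossing, and the pair can be removed. -/
theorem pairSum_insert_insert {v w : Finset P} {i h : P} (hv : ∀ p ∈ v, p < i) (hih : i < h)
    (hw : ∀ p ∈ w, h < p) :
    pairSum φ z (insert i v) (insert h w) =
      pairSum φ z v (insert i (insert h w)) + φ (z i * z h) * pairSum φ z v w := by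
  classical
  -- If `i` were paired beyond `h`, then `h`, which has no partner on the right, would be paired
  -- with a point of `v`, and the two pairs would cross.
  have hmin : ∀ π, IsNCPairing (insert i v ∪ insert h w) π → (∀ p ∈ insert h w, π p ∉ insert h w) →
      π i ∈ insert h w → π i = h := by
    intro π hπ hno hi
    rcases Finset.mem_insert.1 hi with hi | hi
    · exact hi
    exfalso
    have hhi := hw _ hi
    have h1 : π h ∈ insert i v ∪ insert h w := hπ.mem (by simp)
    have h2 : π h ∉ insert h w := hno h (by simp)
    have h3 : π h ≠ i := fun e => by
      rw [← e, hπ.invol] at hhi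
      exact lt_irrefl _ hhi
    have h4 : π h ∈ v := by
      simp only [Finset.mem_union, Finset.mem_insert] at h1 h2
      tauto
    exact hπ.nc (π h) i (hv _ h4) (by rwa [hπ.invol]) (by rwa [hπ.invol])
  have hset : insert i v ∪ insert h w = v ∪ insert i (insert h w) := by
    ext p; simp; tauto
  unfold pairSum
  rw [← Finset.sum_filter_add_sum_filter_not _ (fun π => π i = h), add_comm]
  congr 1
  · rw [Finset.filter_filter, ← hset]
    refine Finset.sum_congr (Finset.filter_congr fun π hπ => ?_) fun _ _ => rfl
    rw [mem_ncPairings] at hπ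
    constructor
    · rintro ⟨h1, h2⟩
      have hi : π i ∉ insert h w := fun hi => h2 (hmin π hπ h1 hi)
      have hii : π i ≠ i := (hπ.supp i).2 (by simp)
      intro p hp
      rcases Finset.mem_insert.1 hp with rfl | hp
      · rw [Finset.mem_insert]; tauto
      · rw [Finset.mem_insert]
        rintro (he | he)
        · apply hi
          rw [← he, hπ.invol]; exact hp
        · exact h1 p hp he
    · intro h1
      refine ⟨fun p hp hp' => h1 p (Finset.mem_insert_of_mem hp) (Finset.mem_insert_of_mem hp'), ?_⟩
      intro he
      exact h1 i (by simp) (by simp [he])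
  · rw [Finset.filter_filter, Finset.mul_sum]
    have hiv : i ∉ v := fun h => lt_irrefl _ (hv _ h)
    have hhv : h ∉ v := fun hh => lt_asymm hih (hv _ hh)
    have hiw : i ∉ w := fun hh => lt_asymm hih (hw _ hh)
    have hhw : h ∉ w := fun hh => lt_irrefl _ (hw _ hh)
    refine Finset.sum_nbij' (togglePair i h true) (togglePair i h false) ?_ ?_ ?_ ?_ ?_
    · intro π hπ
      rw [Finset.mem_filter, mem_ncPairings] at hπ ⊢
      obtain ⟨hπ, hno, hi⟩ := hπ
      have hh : π h = i := by rw [← hi, hπ.invol]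
      have hne : ∀ p, p ≠ i → p ≠ h → π p ≠ i ∧ π p ≠ h := by
        intro p h1 h2
        constructor
        · intro e; apply h2; rw [← hi, ← e, hπ.invol]
        · intro e; apply h1; rw [← hh, ← e, hπ.invol]
      refine ⟨⟨?_, ?_, ?_⟩, ?_⟩
      · intro p
        unfold togglePair
        by_cases h1 : p = i
        · simp [h1]
        by_cases h2 : p = h
        · subst h2; simp [h1]
        simp [h1, h2, hne p h1 h2, hπ.invol]
      · intro p
        unfold togglePair
        by_cases h1 : p = i
        · simp [h1, hiv, hiw]
        by_cases h2 : p = h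
        · subst h2; simp [h1, hhv, hhw]
        have := hπ.supp p
        simp [h1, h2] at this ⊢
        exact this
      · intro p q
        unfold togglePair
        by_cases h1 : p = i
        · subst h1; intro a b; simp at b; exact absurd a b.asymm
        by_cases h2 : p = h
        · subst h2; intro a b; simp [hih.ne'] at b; exact absurd a b.asymm
        by_cases h3 : q = i
        · subst h3; simp [h1, h2]; intro a b; exact b.le
        by_cases h4 : q = h
        · subst h4; simp [h1, h2, h3]; intro a b; exact b.le
        simpa [h1, h2, h3, h4] using hπ.nc p q
      · intro p hp
        have h1 : p ≠ i := fun e => hiw (e ▸ hp)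
        have h2 : p ≠ h := fun e => hhw (e ▸ hp)
        simp only [togglePair, h1, h2, if_false]
        exact fun hc => hno p (by simp [hp]) (by simp [hc])
    · intro π hπ
      rw [Finset.mem_filter, mem_ncPairings] at hπ ⊢
      obtain ⟨hπ, hno⟩ := hπ
      have hi : π i = i := by
        by_contra hc
        have := (hπ.supp i).1 hc
        simp [hiv, hiw] at this
      have hh : π h = h := by
        by_contra hc
        have := (hπ.supp h).1 hc
        simp [hhv, hhw] at this
      have hne : ∀ p, p ≠ i → p ≠ h → π p ≠ i ∧ π p ≠ h := by
        intro p h1 h2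
        constructor
        · intro e; apply h1; rw [← hi, ← e, hπ.invol]
        · intro e; apply h2; rw [← hh, ← e, hπ.invol]
      -- No paired point lies strictly between `i` and `h`, so the inserted pair crosses nothing.
      have hgap : ∀ p, i < p → p < h → π p = p := by
        intro p h1 h2
        by_contra hc
        rcases Finset.mem_union.1 ((hπ.supp p).1 hc) with h3 | h3
        · exact lt_asymm h1 (hv p h3)
        · exact lt_asymm h2 (hw p h3)
      refine ⟨⟨?_, ?_, ?_⟩, ?_, ?_⟩
      · intro p
        unfold togglePair
        by_cases h1 : p = i
        · simp [h1, hih.ne']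
        by_cases h2 : p = h
        · subst h2; simp [h1]
        simp [h1, h2, hne p h1 h2, hπ.invol]
      · intro p
        unfold togglePair
        by_cases h1 : p = i
        · simp [h1, hih.ne']
        by_cases h2 : p = h
        · subst h2; simp [h1, Ne.symm h1]
        have := hπ.supp p
        simp [h1, h2] at this ⊢
        exact this
      · intro p q
        unfold togglePair
        by_cases h1 : p = i
        · subst h1; simp
          intro a b
          have h2 : q ≠ p := a.ne'
          have h3 : q ≠ h := b.ne
          simp [h2, h3, hgap q a b, b.le]
        by_cases h2 : p = h
        · subst h2; intro a b; simp [h1] at b; exact absurd (hih.trans a) b.asymm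
        by_cases h3 : q = i
        · subst h3; simp [h1, h2]; intro a b
          by_contra hc
          push Not at hc
          have := hgap (π p) b hc
          rw [hπ.invol] at this
          exact (a.trans b).ne this
        by_cases h4 : q = h
        · subst h4; simp [h1, h2, h3]; intro a b
          exact (hih.trans b).le
        simpa [h1, h2, h3, h4] using hπ.nc p q
      · intro p hp
        have h1 : p ≠ i := by
          rintro rfl
          rcases Finset.mem_insert.1 hp with e | e
          · exact hih.ne e
          · exact hiw e
        unfold togglePair
        by_cases h2 : p = h
        · simp [h2, hih.ne, hih.ne', hiw]
        · have hp' : p ∈ w := by simpa [h2] using hp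
          simp [h1, h2, hne p h1 h2, hno p hp']
      · simp [togglePair]
    · intro π hπ
      rw [Finset.mem_filter, mem_ncPairings] at hπ
      obtain ⟨hπ, hno, hi⟩ := hπ
      have hh : π h = i := by rw [← hi, hπ.invol]
      funext p
      unfold togglePair
      by_cases h1 : p = i
      · simp [h1, hi]
      by_cases h2 : p = h
      · subst h2; simp [h1, hh]
      simp [h1, h2]
    · intro π hπ
      rw [Finset.mem_filter, mem_ncPairings] at hπ
      obtain ⟨hπ, hno⟩ := hπ
      have hi : π i = i := by
        by_contra hc
        have := (hπ.supp i).1 hc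
        simp [hiv, hiw] at this
      have hh : π h = h := by
        by_contra hc
        have := (hπ.supp h).1 hc
        simp [hhv, hhw] at this
      funext p
      unfold togglePair
      by_cases h1 : p = i
      · simp [h1, hi]
      by_cases h2 : p = h
      · subst h2; simp [h1, hh]
      simp [h1, h2]
    · intro π hπ
      rw [Finset.mem_filter, mem_ncPairings] at hπ
      obtain ⟨hπ, hno, hi⟩ := hπ
      have hh : π h = i := by rw [← hi, hπ.invol]
      rw [← pairWeight_toggle φ z hih]
      · congr 1
        funext p
        unfold togglePair
        by_cases h1 : p = i
        · simp [h1, hi]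
        by_cases h2 : p = h
        · subst h2; simp [h1, hh]
        simp [h1, h2]
      · simp [togglePair]
      · simp [togglePair, hih.ne']

end Pairings

/-! ### Wick products and mixed moments -/

section Wick

variable {A : Type*} [Ring A] [Algebra ℂ A] (φ : A →ₗ[ℂ] ℂ)

/-- The Wick product of a list of semicircular elements. -/
def wick : List A → A
  | [] => 1
  | [a] => a
  | a :: b :: l => a * wick (b :: l) - φ (a * b) • wick l

variable {P : Type*} [LinearOrder P] (z : P → A)

/-- The moment `φ (∏ v z · W (w))`. -/
def wickMoment (v w : Finset P) : ℂ := φ (oprod z v * wick φ (w.sort.map z))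

theorem sort_insert_lt {w : Finset P} {i : P} (h : ∀ p ∈ w, i < p) :
    (insert i w).sort = i :: w.sort :=
  Finset.sort_insert _ (fun p hp => (h p hp).le) fun hi => lt_irrefl _ (h i hi)

omit [Algebra ℂ A] in
theorem oprod_insert_gt {v : Finset P} {i : P} (h : ∀ p ∈ v, p < i) :
    oprod z (insert i v) = oprod z v * z i := by
  have : insert i v = v ∪ {i} := by rw [Finset.union_comm]; rfl
  rw [this, oprod_union, oprod_singleton]
  intro p hp q hq
  rw [Finset.mem_singleton.1 hq]
  exact h p hp

theorem wickMoment_insert_empty {v : Finset P} {i : P} (hv : ∀ p ∈ v, p < i) :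
    wickMoment φ z (insert i v) ∅ = wickMoment φ z v {i} := by
  simp [wickMoment, oprod_insert_gt z hv, wick]

theorem wickMoment_insert_insert {v w : Finset P} {i h : P} (hv : ∀ p ∈ v, p < i) (hih : i < h)
    (hw : ∀ p ∈ w, h < p) :
    wickMoment φ z (insert i v) (insert h w) =
      wickMoment φ z v (insert i (insert h w)) + φ (z i * z h) * wickMoment φ z v w := by
  have hi : ∀ p ∈ insert h w, i < p := by
    intro p hp
    rcases Finset.mem_insert.1 hp with rfl | hp
    · exact hih
    · exact hih.trans (hw p hp)
  simp only [wickMoment, oprod_insert_gt z hv, sort_insert_lt hi, sort_insert_lt hw, List.map_cons,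
    wick, mul_sub, map_sub, mul_assoc, mul_smul_comm, map_smul, smul_eq_mul]
  ring

variable [Fintype P]

/-- Both sides obey the same recursion when the last letter of `v` is moved in front of `w`, so
centredness of the Wick products (`v = ∅`) determines everything. -/
theorem wickMoment_eq_pairSum (h : ∀ w : Finset P, wickMoment φ z ∅ w = if w = ∅ then 1 else 0)
    (v w : Finset P) (hvw : ∀ p ∈ v, ∀ q ∈ w, p < q) : wickMoment φ z v w = pairSum φ z v w := by
  induction v using Finset.induction_on_max generalizing w with
  | empty => rw [h, pairSum_empty_left]
  | insert i v hv ih =>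
    have hiw : ∀ p ∈ w, i < p := fun p hp => hvw i (by simp) p hp
    induction w using Finset.induction_on_min with
    | empty =>
      rw [wickMoment_insert_empty φ z hv, pairSum_insert_empty, ih]
      intro p hp q hq
      rw [Finset.mem_singleton.1 hq]; exact hv p hp
    | insert h' w hw _ =>
      rw [wickMoment_insert_insert φ z hv (hiw _ (by simp)) hw,
        pairSum_insert_insert φ z hv (hiw _ (by simp)) hw, ih, ih]
      · intro p hp q hq
        exact (hv p hp).trans (hiw q (by simp [hq]))
      · intro p hp q hq
        rcases Finset.mem_insert.1 hq with rfl | hq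
        · exact hv p hp
        · exact (hv p hp).trans (hiw q hq)

/-- The same recursion read backwards: it is solved for its term with the longest Wick product, so
the plain moments (`w = ∅`) also determine everything. Applied with `v = ∅`, it shows that Wick
products are centred once the moments are known. -/
theorem wickMoment_eq_pairSum_of_moments
    (h : ∀ v : Finset P, φ (oprod z v) = ∑ π ∈ ncPairings v, pairWeight φ z π)
    (v w : Finset P) (hvw : ∀ p ∈ v, ∀ q ∈ w, p < q) : wickMoment φ z v w = pairSum φ z v w := by
  induction hn : w.card using Nat.strong_induction_on generalizing v w with
  | _ n ihn =>
  induction w using Finset.induction_on_min with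
  | empty => simp [wickMoment, wick, pairSum_empty_right, h]
  | insert i w hw _ =>
    have hv : ∀ p ∈ v, p < i := fun p hp => hvw p hp i (by simp)
    have hiw : i ∉ w := fun hi => lt_irrefl _ (hw i hi)
    rw [Finset.card_insert_of_notMem hiw] at hn
    have h1 : wickMoment φ z (insert i v) w = pairSum φ z (insert i v) w := by
      refine ihn w.card (by omega) _ _ ?_ rfl
      intro p hp q hq
      rcases Finset.mem_insert.1 hp with rfl | hp
      · exact hw q hq
      · exact (hv p hp).trans (hw q hq)
    induction w using Finset.induction_on_min with
    | empty =>
      rw [wickMoment_insert_empty φ z hv, pairSum_insert_empty] at h1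
      exact h1
    | insert j w hj _ =>
      have hjw : j ∉ w := fun hi => lt_irrefl _ (hj j hi)
      rw [Finset.card_insert_of_notMem hjw] at hn
      rw [wickMoment_insert_insert φ z hv (hw _ (by simp)) hj,
        pairSum_insert_insert φ z hv (hw _ (by simp)) hj,
        ihn w.card (by omega) v w (fun p hp q hq => hvw p hp q (by simp [hq])) rfl] at h1
      exact add_right_cancel h1

end Wick

/-! ### Non-crossing partitions of subsets -/

section NonCrossingPartitions

variable {K : Type*} [LinearOrder K]

/-- Non-crossing partitions of a finite subset of a linear order. -/
def IsNonCrossingOn {B : Finset K} (σ : Finpartition B) : Prop :=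
  ∀ D ∈ σ.parts, ∀ D' ∈ σ.parts, D ≠ D' →
    ¬ ∃ i j k l : K, i < j ∧ j < k ∧ k < l ∧ i ∈ D ∧ k ∈ D ∧ j ∈ D' ∧ l ∈ D'

open Classical in
/-- The set of non-crossing partitions of `B`. -/
noncomputable def ncPartitions (B : Finset K) : Finset (Finpartition B) :=
  Finset.univ.filter IsNonCrossingOn

theorem mem_ncPartitions {B : Finset K} {σ : Finpartition B} :
    σ ∈ ncPartitions B ↔ IsNonCrossingOn σ := by
  simp [ncPartitions]

end NonCrossingPartitions

/-! ### Clusters of blocks joined by a pairing -/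

section Clusters

variable {P K : Type*} [LinearOrder P] [LinearOrder K] (b : P → K)

/-- `π` does not connect the blocks in `U` with other blocks. -/
def IsClosedUnder (π : P → P) (U : Finset K) : Prop := ∀ p, b p ∈ U → b (π p) ∈ U

/-- `π` connects the blocks in `D`. -/
def IsConnectedOn (π : P → P) (D : Finset K) : Prop :=
  ∀ U ⊆ D, U.Nonempty → IsClosedUnder b π U → U = D

/-- Two blocks are equivalent if no closed set of blocks separates them. -/
def clusterSetoid (π : P → P) : Setoid K where
  r k j := ∀ U, IsClosedUnder b π U → (k ∈ U ↔ j ∈ U)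
  iseqv := ⟨fun _ _ _ => Iff.rfl, fun h U hU => (h U hU).symm, fun h h' U hU =>
    (h U hU).trans (h' U hU)⟩

open Classical in
/-- The partition of the blocks into connected clusters. -/
noncomputable def clusterPartition (π : P → P) (B : Finset K) : Finpartition B :=
  Finpartition.ofSetSetoid (clusterSetoid b π) B

variable {b}

-- The blocks of `p` and `π p` are never separated, so each class is closed; a nonempty closed
-- subset of a class cannot separate its members, so each class is connected. Conversely, a closed
-- connected set contains the class of each of its members and, by connectedness, equals it.
omit [LinearOrder P] in
theorem clusterPartition_eq_iff {π : P → P} (hπ : ∀ p, π (π p) = p) {B : Finset K}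
    (hB : IsClosedUnder b π B) (σ : Finpartition B) :
    clusterPartition b π B = σ ↔
      ∀ D ∈ σ.parts, IsClosedUnder b π D ∧ IsConnectedOn b π D := by
  classical
  have hrel : ∀ p, clusterSetoid b π (b p) (b (π p)) := by
    intro p U hU
    refine ⟨hU p, fun h => ?_⟩
    have := hU _ h
    rwa [hπ] at this
  have hparts : ∀ k ∈ B, (clusterPartition b π B).part k = {j ∈ B | clusterSetoid b π k j} := by
    intro k hk
    ext j
    rw [clusterPartition, Finpartition.mem_part_ofSetSetoid_iff_rel]
    simp [hk]
  have hmem : ∀ {B' : Finset K} (τ : Finpartition B') (D), D ∈ τ.parts →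
      ∃ k ∈ B', D = τ.part k ∧ k ∈ D := by
    intro B' τ D hD
    obtain ⟨k, hk⟩ := τ.nonempty_of_mem_parts hD
    exact ⟨k, τ.le hD hk, (τ.part_eq_of_mem hD hk).symm, hk⟩
  have hclosed : ∀ k ∈ B, IsClosedUnder b π ((clusterPartition b π B).part k) := by
    intro k hk p hp
    rw [hparts k hk, Finset.mem_filter] at hp ⊢
    exact ⟨hB p hp.1, (clusterSetoid b π).trans' hp.2 (hrel p)⟩
  constructor
  · rintro rfl D hD
    obtain ⟨k, hk, rfl, -⟩ := hmem _ D hD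
    refine ⟨hclosed k hk, fun U hU ⟨j, hj⟩ hUc => hU.antisymm ?_⟩
    intro m hm
    have h1 := hU hj
    rw [hparts k hk, Finset.mem_filter] at hm h1
    exact ((h1.2 U hUc).symm.trans (hm.2 U hUc)).1 hj
  · intro h
    have hsub : ∀ D ∈ σ.parts, ∀ k ∈ D, (clusterPartition b π B).part k = D := by
      intro D hD k hk
      have hkB := σ.le hD hk
      refine (h D hD).2 _ ?_ ⟨k, Finpartition.mem_part _ hkB⟩ (hclosed k hkB)
      intro j hj
      rw [hparts k hkB, Finset.mem_filter] at hj
      exact (hj.2 D (h D hD).1).1 hk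
    ext D
    constructor
    · intro hD
      obtain ⟨k, hk, rfl, -⟩ := hmem _ D hD
      rw [hsub _ (σ.part_mem.2 hk) k (σ.mem_part hk)]
      exact σ.part_mem.2 hk
    · intro hD
      obtain ⟨k, hk⟩ := σ.nonempty_of_mem_parts hD
      rw [← hsub D hD k hk]
      exact Finpartition.part_mem _ |>.2 (σ.le hD hk)

variable [Fintype P]

theorem IsNCPairing.isClosedUnder {π : P → P} {B : Finset K}
    (hπ : IsNCPairing {p | b p ∈ B} π) : IsClosedUnder b π B := by
  intro p hp
  have : p ∈ Finset.univ.filter fun p => b p ∈ B := by simpa using hp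
  simpa using hπ.mem this

variable (hb : Monotone b)
include hb

-- A connected cluster with a block beneath the arc from `p` to `π p` lies wholly beneath it:
-- otherwise some pair of the cluster would leave that region and cross the arc.
omit [Fintype P] in
theorem IsNCPairing.not_separated {π : P → P} {Q : Finset P} (hπ : IsNCPairing Q π)
    {D D' : Finset K} (hDD : Disjoint D D') (hD' : IsClosedUnder b π D')
    (hc : IsConnectedOn b π D') {p : P} (hp : b p ∈ D) (hpp : b (π p) ∈ D)
    {j l : K} (hj : j ∈ D') (hl : l ∈ D') (h1 : b p < j) (h2 : j < b (π p)) :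
    b p < l ∧ l < b (π p) := by
  classical
  by_contra hcon
  -- The part of `D'` beneath the arc is nonempty and omits `l`, so connectedness yields a pair that
  -- leaves it.
  have hU : ¬ IsClosedUnder b π (D'.filter fun m => b p < m ∧ m < b (π p)) := by
    intro hcl
    have := hc _ (Finset.filter_subset _ _) ⟨j, by simp [hj, h1, h2]⟩ hcl
    rw [← this, Finset.mem_filter] at hl
    exact hcon hl.2
  simp only [IsClosedUnder, not_forall] at hU
  obtain ⟨q, hq, hq'⟩ := hU
  rw [Finset.mem_filter] at hq hq'
  have hqD := hD' q hq.1
  have h3 : p < q := lt_of_not_ge fun h => absurd (hb h) (not_le.2 hq.2.1)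
  have h4 : q < π p := lt_of_not_ge fun h => absurd (hb h) (not_le.2 hq.2.2)
  have hne : ∀ m ∈ D, b (π q) ≠ m := fun m hm e =>
    Finset.disjoint_left.1 hDD hm (e ▸ hqD)
  have h5 : b (π q) < b p ∨ b (π p) < b (π q) := by
    rcases lt_or_gt_of_ne (hne _ hp) with h | h
    · exact Or.inl h
    · rcases lt_or_gt_of_ne (hne _ hpp) with h' | h'
      · exact absurd ⟨hqD, h, h'⟩ hq'
      · exact Or.inr h'
  rcases h5 with h5 | h5
  · have h6 : π q < p := lt_of_not_ge fun h => absurd (hb h) (not_le.2 h5)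
    exact hπ.nc (π q) p h6 (by rwa [hπ.invol]) (by rwa [hπ.invol])
  · have h6 : π p < π q := lt_of_not_ge fun h => absurd (hb h) (not_le.2 h5)
    exact hπ.nc p q h3 h4 h6

/-- If clusters `D` and `D'` crossed at `i < j < k < l`, some pair of `D` would leave the interval
between `j` and `l`. Its arc would cover exactly one of the blocks `j`, `l` of the connected cluster
`D'`, against `IsNCPairing.not_separated`. -/
theorem IsNCPairing.isNonCrossingOn {π : P → P} {B : Finset K}
    (hπ : IsNCPairing {p | b p ∈ B} π) : IsNonCrossingOn (clusterPartition b π B) := by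
  classical
  have key := (clusterPartition_eq_iff hπ.invol hπ.isClosedUnder _).1 rfl
  rintro D hD D' hD' hne ⟨i, j, k, l, hij, hjk, hkl, hi, hk, hj, hl⟩
  have hdis : Disjoint D D' := (clusterPartition b π B).disjoint hD hD' hne
  have hU : ¬ IsClosedUnder b π (D.filter fun m => j < m ∧ m < l) := by
    intro hcl
    have := (key D hD).2 _ (Finset.filter_subset _ _) ⟨k, by simp [hk, hjk, hkl]⟩ hcl
    rw [← this, Finset.mem_filter] at hi
    exact lt_asymm hij hi.2.1
  simp only [IsClosedUnder, not_forall] at hU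
  obtain ⟨p, hp, hp'⟩ := hU
  rw [Finset.mem_filter] at hp hp'
  have hpD := (key D hD).1 p hp.1
  have hne : ∀ m ∈ D', b (π p) ≠ m := fun m hm e =>
    Finset.disjoint_right.1 hdis hm (e ▸ hpD)
  have h5 : b (π p) < j ∨ l < b (π p) := by
    rcases lt_or_gt_of_ne (hne _ hj) with h | h
    · exact Or.inl h
    · rcases lt_or_gt_of_ne (hne _ hl) with h' | h'
      · exact absurd ⟨hpD, h, h'⟩ hp'
      · exact Or.inr h'
  obtain ⟨hc1, hc2⟩ := key D' hD'
  rcases h5 with h5 | h5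
  · have := hπ.not_separated hb hdis hc1 hc2 (p := π p) hpD (by rw [hπ.invol]; exact hp.1) hj hl h5
      (by rw [hπ.invol]; exact hp.2.1)
    rw [hπ.invol] at this
    exact lt_asymm hp.2.2 this.2
  · have := hπ.not_separated hb hdis hc1 hc2 hp.1 hpD hl hj hp.2.2 h5
    exact lt_asymm hp.2.1 this.1

variable {A : Type*} [Ring A] [Algebra ℂ A] (φ : A →ₗ[ℂ] ℂ) (z : P → A)

omit hb in
variable (b) in
open Classical in
/-- The sum of the weights of the non-crossing pairings that connect the blocks in `D`. -/
noncomputable def clusterSum (D : Finset K) : ℂ :=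
  ∑ π ∈ (ncPairings {p | b p ∈ D}).filter (fun π => IsConnectedOn b π D), pairWeight φ z π

/-- Restriction to the clusters and gluing are inverse bijections between pairings with clusters `σ`
and families of connected pairings, one for each part; the weight is multiplicative. -/
theorem sum_pairWeight_of_clusterPartition {B : Finset K} (σ : Finpartition B)
    (hσ : IsNonCrossingOn σ) :
    ∑ π ∈ (ncPairings {p | b p ∈ B}) with clusterPartition b π B = σ, pairWeight φ z π =
      ∏ D ∈ σ.parts, clusterSum b φ z D := by
  classical
  simp only [clusterSum]
  rw [Finset.prod_sum]
  let t : Finset K → Finset (P → P) := fun D =>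
    (ncPairings {p | b p ∈ D}).filter (fun π => IsConnectedOn b π D)
  let res : (P → P) → (D : Finset K) → D ∈ σ.parts → P → P :=
    fun π D _ p => if b p ∈ D then π p else p
  let glue : ((D : Finset K) → D ∈ σ.parts → P → P) → P → P :=
    fun g p => if h : b p ∈ B then g (σ.part (b p)) (σ.part_mem.2 h) p else p
  have hglue : ∀ g D (hD : D ∈ σ.parts) p, b p ∈ D → glue g p = g D hD p := by
    intro g D hD p hp
    have h1 := σ.part_eq_of_mem hD hp
    subst h1
    simp only [glue]
    rw [dif_pos (σ.le hD hp)]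
  have hglue' : ∀ g p, b p ∉ B → glue g p = p := fun g p hp => dif_neg hp
  refine Finset.sum_bij' (i := fun π _ => res π) (j := fun g _ => glue g) ?_ ?_ ?_ ?_ ?_
  · intro π hπ
    rw [Finset.mem_filter, mem_ncPairings] at hπ
    obtain ⟨hπ, hσπ⟩ := hπ
    rw [clusterPartition_eq_iff hπ.invol hπ.isClosedUnder] at hσπ
    rw [Finset.mem_pi]
    intro D hD
    rw [Finset.mem_filter, mem_ncPairings]
    refine ⟨⟨?_, ?_, ?_⟩, ?_⟩
    · intro p
      by_cases hp : b p ∈ D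
      · simp [res, hp, (hσπ D hD).1 p hp, hπ.invol]
      · simp [res, hp]
    · intro p
      by_cases hp : b p ∈ D
      · have := (hπ.supp p).2 (by simpa using σ.le hD hp)
        simp [res, hp, this]
      · simp [res, hp]
    · intro p q h1 h2 h3
      by_cases hp : b p ∈ D
      · by_cases hq : b q ∈ D
        · simp only [res, hp, hq, if_true] at h2 h3
          exact hπ.nc p q h1 h2 h3
        · simp only [res, hq, if_false] at h3
          exact lt_asymm h2 h3
      · simp only [res, hp, if_false] at h2
        exact lt_asymm h1 h2
    · intro U hU hne hcl
      refine (hσπ D hD).2 U hU hne fun p hp => ?_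
      have := hcl p hp
      simpa [res, hU hp] using this
  · intro g hg
    rw [Finset.mem_pi] at hg
    have hg' : ∀ D hD, IsNCPairing {p | b p ∈ D} (g D hD) ∧ IsConnectedOn b (g D hD) D := by
      intro D hD
      have := hg D hD
      rwa [Finset.mem_filter, mem_ncPairings] at this
    have hpart : ∀ p, b p ∈ B → ∃ D, D ∈ σ.parts ∧ b p ∈ D := fun p hp =>
      ⟨_, σ.part_mem.2 hp, σ.mem_part hp⟩
    have hnc : IsNCPairing {p | b p ∈ B} (glue g) := by
      refine ⟨?_, ?_, ?_⟩
      · intro p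
        by_cases hp : b p ∈ B
        · obtain ⟨D, hD, hpD⟩ := hpart p hp
          rw [hglue g D hD p hpD, hglue g D hD _ ((hg' D hD).1.isClosedUnder p hpD),
            (hg' D hD).1.invol]
        · rw [hglue' g p hp, hglue' g p hp]
      · intro p
        by_cases hp : b p ∈ B
        · obtain ⟨D, hD, hpD⟩ := hpart p hp
          rw [hglue g D hD p hpD, (hg' D hD).1.supp]
          simp [hp, hpD]
        · simp [hglue' g p hp, hp]
      · intro p q h1 h2 h3
        by_cases hp : b p ∈ B
        · by_cases hq : b q ∈ B
          · obtain ⟨D, hD, hpD⟩ := hpart p hp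
            obtain ⟨D', hD', hqD⟩ := hpart q hq
            have h4 := (hg' D hD).1.isClosedUnder p hpD
            have h5 := (hg' D' hD').1.isClosedUnder q hqD
            rw [hglue g D hD p hpD] at h2 h3
            rw [hglue g D' hD' q hqD] at h3
            by_cases hDD : D = D'
            · subst hDD
              exact (hg' D hD).1.nc p q h1 h2 h3
            · have hlt : ∀ x y, x < y → (b x ∈ D ∧ b y ∈ D' ∨ b x ∈ D' ∧ b y ∈ D) →
                  b x < b y := by
                intro x y hxy h
                refine lt_of_le_of_ne (hb hxy.le) fun e => ?_
                have hd := σ.disjoint hD hD' hDD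
                rcases h with h | h
                · exact Finset.disjoint_left.1 hd h.1 (e ▸ h.2)
                · exact Finset.disjoint_left.1 hd h.2 (e ▸ h.1)
              -- A crossing between letters of different parts descends to a crossing of the parts
              -- in `σ`; the inequalities stay strict because the parts are disjoint.
              exact hσ D hD D' hD' hDD ⟨_, _, _, _, hlt _ _ h1 (Or.inl ⟨hpD, hqD⟩),
                hlt _ _ h2 (Or.inr ⟨hqD, h4⟩), hlt _ _ h3 (Or.inl ⟨h4, h5⟩), hpD, h4, hqD, h5⟩
          · rw [hglue' g q hq] at h3
            exact lt_asymm h2 h3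
        · rw [hglue' g p hp] at h2
          exact lt_asymm h1 h2
    rw [Finset.mem_filter, mem_ncPairings]
    refine ⟨hnc, (clusterPartition_eq_iff hnc.invol hnc.isClosedUnder _).2 fun D hD => ⟨?_, ?_⟩⟩
    · intro p hp
      rw [hglue g D hD p hp]
      exact (hg' D hD).1.isClosedUnder p hp
    · intro U hU hne hcl
      refine (hg' D hD).2 U hU hne fun p hp => ?_
      rw [← hglue g D hD p (hU hp)]
      exact hcl p hp
  · intro π hπ
    rw [Finset.mem_filter, mem_ncPairings] at hπ
    funext p
    by_cases hp : b p ∈ B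
    · rw [hglue _ _ (σ.part_mem.2 hp) p (σ.mem_part hp)]
      simp [res, hp]
    · rw [hglue' _ p hp]
      have := mt (hπ.1.supp p).1 (by simpa using hp)
      simpa [eq_comm] using this
  · intro g hg
    rw [Finset.mem_pi] at hg
    funext D hD p
    have := hg D hD
    rw [Finset.mem_filter, mem_ncPairings] at this
    simp only [res]
    split_ifs with hp
    · exact hglue g D hD p hp
    · have := mt (this.1.supp p).1 (by simpa using hp)
      simpa [eq_comm] using this
  · intro π hπ
    rw [Finset.mem_filter, mem_ncPairings] at hπ
    simp only [pairWeight]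
    rw [Finset.prod_comm]
    refine Finset.prod_congr rfl fun p _ => ?_
    by_cases hp : b p ∈ B
    · rw [Finset.prod_eq_single ⟨σ.part (b p), σ.part_mem.2 hp⟩]
      · simp [res, hp]
      · rintro ⟨D, hD⟩ - hne
        have : b p ∉ D := fun h => hne (Subtype.ext (σ.part_eq_of_mem hD h).symm)
        simp [res, this]
      · intro h; exact absurd (Finset.mem_attach _ _) h
    · have h1 := mt (hπ.1.supp p).1 (by simpa using hp)
      push Not at h1
      rw [h1, if_neg (lt_irrefl _)]
      symm
      refine Finset.prod_eq_one fun D _ => ?_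
      simp [res, h1]

/-- Grouping the pairings by their clusters gives a moment-cumulant formula in which `clusterSum`
plays the role of the cumulant. -/
theorem sum_pairWeight_eq_sum_clusters (B : Finset K) :
    ∑ π ∈ ncPairings {p | b p ∈ B}, pairWeight φ z π =
      ∑ σ ∈ ncPartitions B, ∏ D ∈ σ.parts, clusterSum b φ z D := by
  classical
  rw [← Finset.sum_fiberwise_of_maps_to (g := fun π => clusterPartition b π B)
    (t := ncPartitions B)]
  · refine Finset.sum_congr rfl fun σ hσ => ?_
    exact sum_pairWeight_of_clusterPartition hb φ z σ (mem_ncPartitions.1 hσ)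
  · intro π hπ
    exact mem_ncPartitions.2 ((mem_ncPairings.1 hπ).isNonCrossingOn hb)

end Clusters

/-! ### The moment-cumulant formula on subsets of the index set -/

section MomentCumulant

variable {A : Type*} [CStarAlgebra A] (φ : A →ₗ[ℂ] ℂ)

theorem freeCumulant_congr {m n : ℕ} (h : m = n) (Z : Fin m → A) (X : Fin n → A)
    (hZ : ∀ j, Z j = X (Fin.cast h j)) : freeCumulant φ m Z = freeCumulant φ n X := by
  subst h
  congr 1
  exact funext hZ

/-- The free cumulant of the `X k`, `k ∈ D`. -/
noncomputable def blockCumulant {n : ℕ} (X : Fin n → A) (D : Finset (Fin n)) : ℂ :=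
  freeCumulant φ D.card (restrictTo X D)

theorem blockCumulant_univ {n : ℕ} (X : Fin n → A) :
    blockCumulant φ X Finset.univ = freeCumulant φ n X := by
  refine freeCumulant_congr φ (Finset.card_fin n) _ _ fun j => ?_
  have h2 : (Finset.univ : Finset (Fin n)).orderEmbOfFin rfl =
      (Fin.castOrderIso (Finset.card_fin n)).toOrderEmbedding :=
    (Finset.orderEmbOfFin_unique' rfl fun x => Finset.mem_univ _).symm
  simp only [restrictTo, h2]
  rfl

theorem blockCumulant_map {n m : ℕ} (X : Fin n → A) (e : Fin m ↪o Fin n) (D : Finset (Fin m)) :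
    blockCumulant φ X (D.map e.toEmbedding) = blockCumulant φ (fun j => X (e j)) D := by
  refine freeCumulant_congr φ (Finset.card_map _) _ _ fun j => ?_
  have h2 : (D.map e.toEmbedding).orderEmbOfFin rfl =
      (Fin.castOrderIso (Finset.card_map (e.toEmbedding) (s := D))).toOrderEmbedding.trans
        ((D.orderEmbOfFin rfl).trans e) := by
    symm
    refine Finset.orderEmbOfFin_unique' rfl fun x => ?_
    simp
  simp only [restrictTo, h2]
  rfl

theorem ofFn_restrictTo {A : Type*} {n : ℕ} (X : Fin n → A) (B : Finset (Fin n)) :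
    List.ofFn (restrictTo X B) = B.sort.map X := by
  apply List.ext_getElem
  · simp
  · intro i h1 h2
    simp [restrictTo, Finset.orderEmbOfFin_apply]

/-- The image of a partition under an order embedding. -/
def mapPartition {m n : ℕ} (e : Fin m ↪o Fin n) {B : Finset (Fin n)}
    (hB : ∀ k, k ∈ B ↔ ∃ j, e j = k) (σ : Finpartition (Finset.univ : Finset (Fin m))) :
    Finpartition B :=
  Finpartition.ofExistsUnique (σ.parts.image fun D => D.map e.toEmbedding)
    (by
      intro p hp k hk
      obtain ⟨D, hD, rfl⟩ := Finset.mem_image.1 hp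
      obtain ⟨j, hj, rfl⟩ := Finset.mem_map.1 hk
      exact (hB _).2 ⟨j, rfl⟩)
    (by
      intro k hk
      obtain ⟨j, rfl⟩ := (hB k).1 hk
      refine ⟨(σ.part j).map e.toEmbedding, ⟨Finset.mem_image_of_mem _ (σ.part_mem.2 (by simp)),
        Finset.mem_map_of_mem e.toEmbedding (σ.mem_part (by simp))⟩, ?_⟩
      rintro D' ⟨hD', hj⟩
      obtain ⟨D, hD, rfl⟩ := Finset.mem_image.1 hD'
      have hj' : j ∈ D := by simpa using hj
      rw [σ.part_eq_of_mem hD hj'])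
    (by
      intro h
      obtain ⟨D, hD, h⟩ := Finset.mem_image.1 h
      exact (σ.nonempty_of_mem_parts hD).ne_empty (Finset.map_eq_empty.1 h))

/-- The preimage of a partition under an order embedding. -/
def comapPartition {m n : ℕ} (e : Fin m ↪o Fin n) {B : Finset (Fin n)}
    (hB : ∀ k, k ∈ B ↔ ∃ j, e j = k) (τ : Finpartition B) :
    Finpartition (Finset.univ : Finset (Fin m)) :=
  Finpartition.ofExistsUnique (τ.parts.image fun D => Finset.univ.filter fun j => e j ∈ D)
    (fun _ _ => Finset.subset_univ _)
    (by
      intro j _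
      have hj : e j ∈ B := (hB _).2 ⟨j, rfl⟩
      refine ⟨Finset.univ.filter fun i => e i ∈ τ.part (e j),
        ⟨Finset.mem_image_of_mem _ (τ.part_mem.2 hj), by simpa using hj⟩, ?_⟩
      rintro D' ⟨hD', hj'⟩
      obtain ⟨D, hD, rfl⟩ := Finset.mem_image.1 hD'
      rw [τ.part_eq_of_mem hD (by simpa using hj')])
    (by
      intro h
      obtain ⟨D, hD, h⟩ := Finset.mem_image.1 h
      obtain ⟨k, hk⟩ := τ.nonempty_of_mem_parts hD
      obtain ⟨j, rfl⟩ := (hB k).1 (τ.le hD hk)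
      have : j ∈ Finset.univ.filter fun i => e i ∈ D := by simpa using hk
      rw [h] at this
      simp at this)

/-- The free moment-cumulant formula for the subfamilies of a family. -/
theorem moment_eq_sum_blockCumulant {n : ℕ} (X : Fin n → A) {B : Finset (Fin n)}
    (hBn : B.Nonempty) :
    φ (oprod X B) = ∑ σ ∈ ncPartitions B, ∏ D ∈ σ.parts, blockCumulant φ X D := by
  classical
  -- The formula for the tuple indexed by `Fin B.card` is transported along the increasing
  -- enumeration of `B`.
  have h1 := moment_eq_sum_freeCumulant φ hBn.card_pos (restrictTo X B)
  rw [ofFn_restrictTo] at h1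
  rw [oprod, h1]
  let e := B.orderEmbOfFin rfl
  have hB : ∀ k, k ∈ B ↔ ∃ j, e j = k := by
    intro k
    rw [← Finset.mem_coe, ← Finset.range_orderEmbOfFin B rfl]
    rfl
  have hmc : ∀ D : Finset (Fin n), D ⊆ B →
      (Finset.univ.filter fun j => e j ∈ D).map e.toEmbedding = D := by
    intro D hD
    ext k
    simp only [Finset.mem_map, Finset.mem_filter, Finset.mem_univ, true_and]
    constructor
    · rintro ⟨j, hj, rfl⟩; exact hj
    · intro hk
      obtain ⟨j, rfl⟩ := (hB k).1 (hD hk)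
      exact ⟨j, hk, rfl⟩
  have hcm : ∀ D : Finset (Fin B.card),
      (Finset.univ.filter fun j => e j ∈ D.map e.toEmbedding) = D := by
    intro D; ext j; simp
  refine Finset.sum_bij' (i := fun σ _ => mapPartition e hB σ)
    (j := fun τ _ => comapPartition e hB τ) ?_ ?_ ?_ ?_ ?_
  · intro σ hσ
    simp only [NC, Finset.mem_filter, Finset.mem_univ, true_and] at hσ
    rw [mem_ncPartitions]
    rintro D hD D' hD' hne ⟨i, j, k, l, hij, hjk, hkl, hi, hk, hj, hl⟩
    obtain ⟨C, hC, rfl⟩ := Finset.mem_image.1 hD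
    obtain ⟨C', hC', rfl⟩ := Finset.mem_image.1 hD'
    obtain ⟨i, hi', rfl⟩ := Finset.mem_map.1 hi
    obtain ⟨j, hj', rfl⟩ := Finset.mem_map.1 hj
    obtain ⟨k, hk', rfl⟩ := Finset.mem_map.1 hk
    obtain ⟨l, hl', rfl⟩ := Finset.mem_map.1 hl
    refine hσ C hC C' hC' (fun h => hne (by rw [h])) ⟨i, j, k, l, ?_, ?_, ?_, hi', hk', hj', hl'⟩
    · exact e.lt_iff_lt.1 hij
    · exact e.lt_iff_lt.1 hjk
    · exact e.lt_iff_lt.1 hkl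
  · intro τ hτ
    simp only [NC, Finset.mem_filter, Finset.mem_univ, true_and]
    rw [mem_ncPartitions] at hτ
    rintro D hD D' hD' hne ⟨i, j, k, l, hij, hjk, hkl, hi, hk, hj, hl⟩
    obtain ⟨C, hC, rfl⟩ := Finset.mem_image.1 hD
    obtain ⟨C', hC', rfl⟩ := Finset.mem_image.1 hD'
    simp only [Finset.mem_filter, Finset.mem_univ, true_and] at hi hj hk hl
    exact hτ C hC C' hC' (fun h => hne (by rw [h])) ⟨e i, e j, e k, e l, e.lt_iff_lt.2 hij,
      e.lt_iff_lt.2 hjk, e.lt_iff_lt.2 hkl, hi, hk, hj, hl⟩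
  · intro σ _
    apply Finpartition.ext
    simp only [comapPartition, mapPartition, Finpartition.ofExistsUnique_parts, Finset.image_image]
    conv_rhs => rw [← Finset.image_id (s := σ.parts)]
    exact Finset.image_congr fun D _ => hcm D
  · intro τ _
    apply Finpartition.ext
    change Finset.image _ (Finset.image _ τ.parts) = τ.parts
    conv_rhs => rw [← Finset.image_id (s := τ.parts)]
    rw [Finset.image_image]
    exact Finset.image_congr fun D hD => hmc D (τ.le hD)
  · intro σ _
    simp only [mapPartition, Finpartition.ofExistsUnique_parts]
    rw [Finset.prod_image]
    · refine Finset.prod_congr rfl fun D _ => ?_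
      rw [blockCumulant_map]
      rfl
    · intro D _ D' _ h
      exact Finset.map_injective _ h

end MomentCumulant

/-! ### Moments of one semicircular element -/

section SingleSemicircular

variable {A : Type*} [CStarAlgebra A] {φ : A →ₗ[ℂ] ℂ}

/-- The only other partition of two points consists of singletons, and contributes zero for a
centred element. -/
theorem moment_two_eq_freeCumulant {x : A} (h1 : freeCumulant φ 1 (fun _ => x) = 0) :
    freeCumulant φ 2 (fun _ => x) = φ (x * x) := by
  classical
  have h := moment_eq_sum_blockCumulant φ (fun _ : Fin 2 => x) (B := Finset.univ) ⟨0, by simp⟩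
  have hl : φ (oprod (fun _ : Fin 2 => x) Finset.univ) = φ (x * x) := by
    have : (Finset.univ : Finset (Fin 2)) = {0} ∪ {1} := by decide
    rw [this, oprod_union, oprod_singleton, oprod_singleton]
    simp
  have hne : (Finset.univ : Finset (Fin 2)) ≠ ⊥ := Finset.univ_nonempty.ne_empty
  rw [← hl, h, Finset.sum_eq_single (Finpartition.indiscrete hne)]
  · simp [blockCumulant_univ]
  · intro σ _ hσ
    have h0 := σ.part_mem.2 (Finset.mem_univ (0 : Fin 2))
    refine Finset.prod_eq_zero h0 ?_
    have hcard : (σ.part 0).card = 1 := by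
      have hle : (σ.part 0).card ≤ 2 := by simpa using Finset.card_le_univ (σ.part 0)
      have hpos : 0 < (σ.part 0).card := Finset.card_pos.2 (σ.nonempty_of_mem_parts h0)
      have hne2 : (σ.part 0).card ≠ 2 := by
        intro hc
        apply hσ
        have hu : σ.part 0 = Finset.univ := Finset.eq_univ_of_card _ (by simpa using hc)
        rw [hu] at h0
        ext D
        simp only [Finpartition.indiscrete_parts, Finset.mem_singleton]
        constructor
        · intro hD
          obtain ⟨k, hk⟩ := σ.nonempty_of_mem_parts hD
          exact σ.eq_of_mem_parts hD h0 hk (Finset.mem_univ k)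
        · rintro rfl; exact h0
      omega
    rw [← h1]
    exact freeCumulant_congr φ hcard _ _ fun _ => rfl
  · intro h
    refine absurd (mem_ncPartitions.2 ?_) h
    intro D hD D' hD' hne'
    simp only [Finpartition.indiscrete_parts, Finset.mem_singleton] at hD hD'
    exact absurd (hD.trans hD'.symm) hne'

/-- With one letter per block, each pair is closed by itself, so a connected pairing is a single
pair. -/
theorem clusterSum_id {P : Type*} [LinearOrder P] [Fintype P] (φ : A →ₗ[ℂ] ℂ) (x : A)
    {D : Finset P} (hD : D.Nonempty) :
    clusterSum (id : P → P) φ (fun _ => x) D = if D.card = 2 then φ (x * x) else 0 := by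
  classical
  have hDid : (Finset.univ.filter fun p : P => id p ∈ D) = D := by ext; simp
  unfold clusterSum
  rw [hDid]
  split_ifs with hc
  · obtain ⟨i, j, hij, rfl⟩ : ∃ i j, i < j ∧ D = {i, j} := by
      obtain ⟨i, j, hij, rfl⟩ := Finset.card_eq_two.1 hc
      rcases lt_or_gt_of_ne hij with h | h
      · exact ⟨i, j, h, rfl⟩
      · exact ⟨j, i, h, Finset.pair_comm i j⟩
    have hset : (ncPairings ({i, j} : Finset P)).filter (fun π => IsConnectedOn id π {i, j}) =
        {togglePair i j false id} := by
      ext π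
      rw [Finset.mem_filter, mem_ncPairings, Finset.mem_singleton]
      constructor
      · rintro ⟨hπ, -⟩
        have hi : π i = j := by
          have h1 := hπ.mem (p := i) (by simp)
          have h2 := (hπ.supp i).2 (by simp)
          simp only [Finset.mem_insert, Finset.mem_singleton] at h1
          tauto
        have hj : π j = i := by rw [← hi, hπ.invol]
        funext p
        unfold togglePair
        by_cases h1 : p = i
        · simp [h1, hi]
        by_cases h2 : p = j
        · subst h2; simp [h1, hj]
        have := mt (hπ.supp p).1 (by simp [h1, h2])
        simpa [h1, h2] using this
      · rintro rfl
        have hti : togglePair i j false id i = j := by simp [togglePair]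
        have htj : togglePair i j false id j = i := by simp [togglePair, hij.ne']
        have ht : ∀ p, p ≠ i → p ≠ j → togglePair i j false id p = p := by
          intro p h1 h2; simp [togglePair, h1, h2]
        refine ⟨⟨?_, ?_, ?_⟩, ?_⟩
        · intro p
          by_cases h1 : p = i
          · rw [h1, hti, htj]
          by_cases h2 : p = j
          · rw [h2, htj, hti]
          rw [ht p h1 h2, ht p h1 h2]
        · intro p
          by_cases h1 : p = i
          · simp [h1, hti, hij.ne']
          by_cases h2 : p = j
          · simp [h2, htj, hij.ne]
          simp [ht p h1 h2, h1, h2]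
        · intro p q h1 h2
          by_cases hp : p = i
          · subst hp
            rw [hti] at h2 ⊢
            rw [ht q h1.ne' h2.ne]
            exact h2.asymm
          by_cases hp' : p = j
          · subst hp'
            rw [htj] at h2
            exact absurd (hij.trans h1) h2.asymm
          rw [ht p hp hp'] at h2
          exact absurd h1 h2.asymm
        · intro U hU hne hcl
          refine hU.antisymm ?_
          have h1 : i ∈ U ∧ j ∈ U := by
            obtain ⟨p, hp⟩ := hne
            have h2 := hcl p hp
            have h3 := hU hp
            simp only [Finset.mem_insert, Finset.mem_singleton, id] at h2 h3
            rcases h3 with rfl | rfl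
            · exact ⟨hp, by rwa [hti] at h2⟩
            · exact ⟨by rwa [htj] at h2, hp⟩
          intro p hp
          simp only [Finset.mem_insert, Finset.mem_singleton] at hp
          rcases hp with rfl | rfl
          · exact h1.1
          · exact h1.2
    rw [hset, Finset.sum_singleton, pairWeight_toggle _ _ hij rfl rfl]
    simp [pairWeight]
  · refine Finset.sum_eq_zero fun π hπ => absurd ?_ hc
    rw [Finset.mem_filter, mem_ncPairings] at hπ
    obtain ⟨hπ, hcon⟩ := hπ
    obtain ⟨p, hp⟩ := hD
    have h1 := hcon {p, π p} ?_ ⟨p, by simp⟩ ?_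
    · rw [← h1, Finset.card_pair ((hπ.supp p).2 hp).symm]
    · intro q hq
      simp only [Finset.mem_insert, Finset.mem_singleton] at hq
      rcases hq with rfl | rfl
      · exact hp
      · exact hπ.mem hp
    · intro q hq
      simp only [Finset.mem_insert, Finset.mem_singleton, id] at hq ⊢
      rcases hq with rfl | rfl
      · simp
      · simp [hπ.invol]

/-- For one-letter blocks the cluster sums and the cumulants of `x` agree: both vanish except on two
points, where both are `φ (x * x)`. So the two moment expansions coincide. -/
theorem IsSemicircular.moment {x : A} (hφ : φ 1 = 1) (hx : IsSemicircular φ x) {n : ℕ}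
    (v : Finset (Fin n)) :
    φ (oprod (fun _ => x) v) = ∑ π ∈ ncPairings v, pairWeight φ (fun _ => x) π := by
  rcases v.eq_empty_or_nonempty with rfl | hv
  · rw [← pairSum_empty_right, pairSum_empty_left]
    simp [hφ]
  · obtain ⟨-, s, -, hs⟩ := hx
    have h := sum_pairWeight_eq_sum_clusters (b := (id : Fin n → Fin n)) monotone_id φ
      (fun _ => x) v
    have hv' : (Finset.univ.filter fun p : Fin n => id p ∈ v) = v := by ext; simp
    rw [hv'] at h
    rw [h, moment_eq_sum_blockCumulant φ _ hv]
    refine Finset.sum_congr rfl fun σ _ => Finset.prod_congr rfl fun D hD => ?_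
    have hDn := σ.nonempty_of_mem_parts hD
    rw [clusterSum_id φ x hDn, ← moment_two_eq_freeCumulant (by simpa using hs 1 le_rfl),
      hs 2 (by norm_num)]
    exact hs D.card hDn.card_pos

theorem IsSemicircular.wick_replicate {x : A} (hφ : φ 1 = 1) (hx : IsSemicircular φ x) {m : ℕ}
    (hm : 0 < m) : φ (wick φ (List.replicate m x)) = 0 := by
  have h := wickMoment_eq_pairSum_of_moments φ (fun _ : Fin m => x) (fun v => hx.moment hφ v)
    ∅ Finset.univ (by simp)
  rw [pairSum_empty_left, if_neg] at h
  · simpa [wickMoment] using h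
  · exact (Finset.univ_nonempty_iff.2 ⟨⟨0, hm⟩⟩).ne_empty

end SingleSemicircular

/-! ### The Wick formula for free semicircular families and their span -/

section WickFormula

variable {A ι : Type*} [CStarAlgebra A] {φ : A →ₗ[ℂ] ℂ}

/-- The recursion contracts neighbours only, and the one contraction across the junction vanishes.
-/
theorem wick_replicate_append {a : A} {L : List A} (h : ∀ c ∈ L.head?, φ (a * c) = 0) (m : ℕ) :
    wick φ (List.replicate m a ++ L) = wick φ (List.replicate m a) * wick φ L := by
  induction m using Nat.twoStepInduction with
  | zero => simp [wick]
  | one =>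
    cases L with
    | nil => simp [wick]
    | cons c t => simp [wick, h c (by simp)]
  | more m ih1 ih2 =>
    simp only [List.replicate_succ, List.cons_append, wick] at ih1 ih2 ⊢
    rw [ih1, ih2, sub_mul, mul_assoc, smul_mul_assoc]

theorem wick_replicate_mem (a : A) (m : ℕ) :
    wick φ (List.replicate m a) ∈ Algebra.adjoin ℂ {a} := by
  have ha : a ∈ Algebra.adjoin ℂ {a} := Algebra.subset_adjoin rfl
  induction m using Nat.twoStepInduction with
  | zero => simp [wick]
  | one => simp [wick]
  | more m ih1 ih2 =>
    simp only [List.replicate_succ, wick] at ih1 ih2 ⊢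
    exact sub_mem (mul_mem ha ih2) (Subalgebra.smul_mem _ ih1 _)

theorem exists_eq_replicate_append (i : ι) (t : List ι) :
    ∃ m L, i :: t = List.replicate (m + 1) i ++ L ∧ i ∉ L.head? ∧ L.length < (i :: t).length := by
  classical
  induction t generalizing i with
  | nil => exact ⟨0, [], by simp⟩
  | cons j t ih =>
    by_cases hij : i = j
    · subst hij
      obtain ⟨m, L, h1, h2, h3⟩ := ih i
      refine ⟨m + 1, L, ?_, h2, by simp at h3 ⊢; omega⟩
      rw [h1, List.replicate_succ (n := m + 1), List.cons_append]
    · exact ⟨0, j :: t, by simp, by simpa [eq_comm] using hij, by simp⟩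

theorem IsFreeFamily.list_prod {B : ι → Subalgebra ℂ A} (h : IsFreeFamily φ B)
    (l : List (ι × A)) (hl : l ≠ []) (hB : ∀ q ∈ l, q.2 ∈ B q.1) (h0 : ∀ q ∈ l, φ q.2 = 0)
    (hc : l.IsChain (fun q q' => q.1 ≠ q'.1)) : φ (l.map Prod.snd).prod = 0 := by
  obtain ⟨q, t, rfl⟩ := List.exists_cons_of_ne_nil hl
  have := h t.length (fun j => ((q :: t).get j).1) (fun j => ((q :: t).get j).2)
    (fun j => hB _ (List.get_mem _ _)) (fun j => h0 _ (List.get_mem _ _)) ?_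
  · have h2 : List.ofFn (fun j : Fin (t.length + 1) => ((q :: t).get j).2) =
        (q :: t).map Prod.snd := by
      change List.ofFn (Prod.snd ∘ (q :: t).get) = _
      rw [← List.map_ofFn, List.ofFn_get]
    rwa [h2] at this
  · intro j
    have := List.isChain_iff_getElem.1 hc j.1 (by simp)
    simpa using this

variable {x : ι → A}

/-- Distinct members have zero covariance, so the Wick product factors at the end of each run of
equal letters. Each run gives a centred polynomial in one generator. Recording the index of the
first factor lets the induction keep neighbouring indices different. -/
theorem IsFreeSemicircularFamily.exists_alternating (hφ : φ 1 = 1)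
    (h : IsFreeSemicircularFamily φ x) (i : ι) (t : List ι) :
    ∃ l : List (ι × A), l.head?.map Prod.fst = some i ∧
      (∀ q ∈ l, q.2 ∈ Algebra.adjoin ℂ {x q.1}) ∧ (∀ q ∈ l, φ q.2 = 0) ∧
      l.IsChain (fun q q' => q.1 ≠ q'.1) ∧ wick φ ((i :: t).map x) = (l.map Prod.snd).prod := by
  have hcent : ∀ i, φ (x i) = 0 := fun i => by
    simpa [wick] using (h.1 i).wick_replicate hφ one_pos
  have hcov : ∀ i j, i ≠ j → φ (x i * x j) = 0 := by
    intro i j hij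
    have := h.2.list_prod [(i, x i), (j, x j)] (by simp)
      (by simp [Algebra.self_mem_adjoin_singleton]) (by simp [hcent]) (by simpa using hij)
    simpa using this
  induction hn : t.length using Nat.strong_induction_on generalizing i t with
  | _ n ih =>
  obtain ⟨m, L, h1, h2, h3⟩ := exists_eq_replicate_append i t
  have hw : wick φ ((i :: t).map x) =
      wick φ (List.replicate (m + 1) (x i)) * wick φ (L.map x) := by
    rw [h1, List.map_append, List.map_replicate]
    apply wick_replicate_append
    intro c hc
    rw [List.head?_map, Option.mem_map] at hc
    obtain ⟨j, hj, rfl⟩ := hc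
    exact hcov i j fun e => h2 (e ▸ hj)
  have hm0 := (h.1 i).wick_replicate hφ (Nat.succ_pos m)
  have hmm := wick_replicate_mem (φ := φ) (x i) (m + 1)
  cases L with
  | nil =>
    refine ⟨[(i, wick φ (List.replicate (m + 1) (x i)))], by simp, by simpa using hmm,
      by simpa using hm0, by simp, ?_⟩
    rw [hw]; simp [wick]
  | cons j L =>
    obtain ⟨l, hl1, hl2, hl3, hl4, hl5⟩ := ih L.length (by simp at h3; omega) j L rfl
    refine ⟨(i, wick φ (List.replicate (m + 1) (x i))) :: l, by simp, ?_, ?_, ?_, ?_⟩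
    · intro q hq
      rcases List.mem_cons.1 hq with rfl | hq
      · exact hmm
      · exact hl2 q hq
    · intro q hq
      rcases List.mem_cons.1 hq with rfl | hq
      · exact hm0
      · exact hl3 q hq
    · cases l with
      | nil => simp at hl1
      | cons q l =>
        refine List.isChain_cons_cons.2 ⟨?_, hl4⟩
        simp at hl1 h2
        rw [hl1]
        exact fun e => h2 e.symm
    · rw [hw, hl5]; simp

theorem IsFreeSemicircularFamily.wick_map (hφ : φ 1 = 1) (h : IsFreeSemicircularFamily φ x)
    {L : List ι} (hL : L ≠ []) : φ (wick φ (L.map x)) = 0 := by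
  obtain ⟨i, t, rfl⟩ := List.exists_cons_of_ne_nil hL
  obtain ⟨l, hl1, hl2, hl3, hl4, hl5⟩ := h.exists_alternating hφ i t
  rw [hl5]
  refine h.2.list_prod l ?_ hl2 hl3 hl4
  rintro rfl
  simp at hl1

theorem wick_add (l₁ : List A) (a b : A) (l₂ : List A) :
    wick φ (l₁ ++ (a + b) :: l₂) = wick φ (l₁ ++ a :: l₂) + wick φ (l₁ ++ b :: l₂) := by
  induction l₁ using List.twoStepInduction with
  | nil =>
    cases l₂ with
    | nil => simp [wick]
    | cons c t => simp only [List.nil_append, wick, add_mul, map_add, add_smul]; abel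
  | singleton c =>
    simp only [List.cons_append, List.nil_append, wick, mul_add, map_add, add_smul]
    cases l₂ with
    | nil => simp only [wick]; noncomm_ring
    | cons d t => simp only [wick, add_mul, map_add, add_smul]; noncomm_ring
  | cons_cons c d l₁ ih1 ih2 =>
    simp only [List.cons_append, wick] at ih1 ih2 ⊢
    rw [ih1, ih2 d, mul_add, smul_add]
    abel

theorem wick_smul (l₁ : List A) (c : ℂ) (a : A) (l₂ : List A) :
    wick φ (l₁ ++ (c • a) :: l₂) = c • wick φ (l₁ ++ a :: l₂) := by
  induction l₁ using List.twoStepInduction with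
  | nil =>
    cases l₂ with
    | nil => simp [wick]
    | cons d t => simp [wick, smul_sub, mul_smul]
  | singleton d =>
    cases l₂ with
    | nil => simp [wick, smul_sub, mul_smul]
    | cons d t => simp [wick, smul_sub, mul_smul, mul_sub]
  | cons_cons d e l₁ ih1 ih2 =>
    simp only [List.cons_append, wick] at ih1 ih2 ⊢
    rw [ih1, ih2 e, mul_smul_comm, smul_sub, smul_comm c]

/-- By multilinearity, the last letter of `l` may be taken to be a generator, which then passes into
`L`; the list `l` is exhausted from the right. -/
theorem IsFreeSemicircularFamily.wick_of_mem_span (hφ : φ 1 = 1)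
    (h : IsFreeSemicircularFamily φ x) (l : List A) (L : List ι) (hne : l ++ L.map x ≠ [])
    (hl : ∀ a ∈ l, a ∈ Submodule.span ℂ (Set.range x)) : φ (wick φ (l ++ L.map x)) = 0 := by
  induction l using List.reverseRecOn generalizing L with
  | nil => exact h.wick_map hφ (by simpa using hne)
  | append_singleton l a ih =>
    have ha := hl a (by simp)
    have hl' : ∀ a ∈ l, a ∈ Submodule.span ℂ (Set.range x) := fun a ha => hl a (by simp [ha])
    rw [List.append_assoc, List.singleton_append]
    clear hne hl
    induction ha using Submodule.span_induction with
    | mem a ha =>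
      obtain ⟨i, rfl⟩ := ha
      exact ih (i :: L) (by simp) hl'
    | zero => simpa using congrArg φ (wick_smul (φ := φ) l 0 0 (L.map x))
    | add a b _ _ iha ihb => rw [wick_add, map_add, iha, ihb, add_zero]
    | smul c a _ iha => rw [wick_smul, map_smul, iha, smul_zero]

/-- The Wick formula for elements of the linear span of a free semicircular family. -/
theorem IsFreeSemicircularFamily.moment_eq_sum_pairings (hφ : φ 1 = 1)
    (h : IsFreeSemicircularFamily φ x) {P : Type*} [LinearOrder P] [Fintype P] (z : P → A)
    (hz : ∀ p, z p ∈ Submodule.span ℂ (Set.range x)) (Q : Finset P) :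
    φ (oprod z Q) = ∑ π ∈ ncPairings Q, pairWeight φ z π := by
  have h1 : ∀ w : Finset P, wickMoment φ z ∅ w = if w = ∅ then 1 else 0 := by
    intro w
    split_ifs with hw
    · subst hw; simp [wickMoment, wick, hφ]
    · have := h.wick_of_mem_span hφ (w.sort.map z) [] ?_ ?_
      · simpa [wickMoment] using this
      · simpa [← List.length_eq_zero_iff] using hw
      · intro a ha
        obtain ⟨p, -, rfl⟩ := List.mem_map.1 ha
        exact hz p
  have h2 := wickMoment_eq_pairSum φ z h1 Q ∅ (by simp)
  rw [pairSum_empty_right] at h2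
  simpa [wickMoment, wick] using h2

end WickFormula

/-! ### Cumulants of block products and multilinearity -/

section Recursion

variable {A : Type*} [CStarAlgebra A] (φ : A →ₗ[ℂ] ℂ) {n : ℕ}

theorem indiscrete_mem_ncPartitions {K : Type*} [LinearOrder K] {B : Finset K} (hB : B ≠ ⊥) :
    Finpartition.indiscrete hB ∈ ncPartitions B := by
  refine mem_ncPartitions.2 ?_
  intro D hD D' hD' hne'
  simp only [Finpartition.indiscrete_parts, Finset.mem_singleton] at hD hD'
  exact absurd (hD.trans hD'.symm) hne'

theorem ssubset_of_ne_indiscrete {K : Type*} [LinearOrder K] {B : Finset K} (hB : B ≠ ⊥)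
    {σ : Finpartition B} (hσ : σ ≠ Finpartition.indiscrete hB) {D : Finset K} (hD : D ∈ σ.parts) :
    D ⊂ B := by
  refine (σ.le hD).ssubset_of_ne ?_
  rintro rfl
  apply hσ
  ext C
  simp only [Finpartition.indiscrete_parts, Finset.mem_singleton]
  constructor
  · intro hC
    obtain ⟨k, hk⟩ := σ.nonempty_of_mem_parts hC
    exact σ.eq_of_mem_parts hC hD hk (σ.le hC hk)
  · rintro rfl; exact hD

theorem sum_ncPartitions {K : Type*} [LinearOrder K] {B : Finset K} (hB : B ≠ ⊥)
    (c : Finset K → ℂ) :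
    ∑ σ ∈ ncPartitions B, ∏ D ∈ σ.parts, c D =
      c B + ∑ σ ∈ (ncPartitions B).erase (Finpartition.indiscrete hB), ∏ D ∈ σ.parts, c D := by
  rw [← Finset.add_sum_erase _ _ (indiscrete_mem_ncPartitions hB)]
  simp

/-- Free cumulants of the ordered products over the blocks of a family that satisfies the Wick
formula. -/
theorem blockCumulant_eq_clusterSum {P : Type*} [LinearOrder P] [Fintype P] {b : P → Fin n}
    (hb : Monotone b) (z : P → A)
    (hz : ∀ Q : Finset P, φ (oprod z Q) = ∑ π ∈ ncPairings Q, pairWeight φ z π)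
    (B : Finset (Fin n)) (hBn : B.Nonempty) :
    blockCumulant φ (fun k => oprod z {p | b p = k}) B = clusterSum b φ z B := by
  induction B using Finset.strongInduction with
  | H B ih =>
  have hB : B ≠ ⊥ := hBn.ne_empty
  have h1 := moment_eq_sum_blockCumulant φ (fun k => oprod z {p | b p = k}) hBn
  -- Both families expand the same moment over non-crossing partitions. All parts other than `B`
  -- itself are proper subsets, covered by induction, so the one-block terms agree.
  rw [oprod_fibres b hb, hz, sum_pairWeight_eq_sum_clusters hb, sum_ncPartitions hB,
    sum_ncPartitions hB] at h1
  have h2 : ∑ σ ∈ (ncPartitions B).erase (Finpartition.indiscrete hB),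
      ∏ D ∈ σ.parts, clusterSum b φ z D =
      ∑ σ ∈ (ncPartitions B).erase (Finpartition.indiscrete hB),
      ∏ D ∈ σ.parts, blockCumulant φ (fun k => oprod z {p | b p = k}) D := by
    refine Finset.sum_congr rfl fun σ hσ => Finset.prod_congr rfl fun D hD => ?_
    exact (ih D (ssubset_of_ne_indiscrete hB (Finset.ne_of_mem_erase hσ) hD)
      (σ.nonempty_of_mem_parts hD)).symm
  rw [h2] at h1
  exact (add_right_cancel h1).symm

theorem blockCumulant_update_of_notMem (X : Fin n → A) {k : Fin n} {B : Finset (Fin n)}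
    (hk : k ∉ B) (a : A) :
    blockCumulant φ (Function.update X k a) B = blockCumulant φ X B := by
  unfold blockCumulant
  congr 1
  funext j
  refine Function.update_of_ne ?_ _ _
  rintro h
  exact hk (h ▸ Finset.orderEmbOfFin_mem B rfl j)

theorem oprod_update {P : Type*} [LinearOrder P] (X : P → A) {k : P} {B : Finset P} (hk : k ∈ B) :
    ∃ u v : A, ∀ a, oprod (Function.update X k a) B = u * a * v := by
  obtain ⟨s, t, hst⟩ := List.append_of_mem ((Finset.mem_sort (· ≤ ·)).2 hk)
  have hnd := Finset.sort_nodup B (· ≤ ·)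
  rw [hst, List.nodup_append] at hnd
  have hs : k ∉ s := fun h => hnd.2.2 k h k (by simp) rfl
  have ht : k ∉ t := (List.nodup_cons.1 hnd.2.1).1
  have aux : ∀ (l : List P) (a : A), k ∉ l → l.map (Function.update X k a) = l.map X := by
    intro l a hl
    refine List.map_congr_left fun p hp => Function.update_of_ne ?_ _ _
    rintro rfl; exact hl hp
  refine ⟨(s.map X).prod, (t.map X).prod, fun a => ?_⟩
  simp [oprod, hst, aux s a hs, aux t a ht, mul_assoc]

theorem blockCumulant_update (X : Fin n → A) {k : Fin n} {B : Finset (Fin n)} (hk : k ∈ B)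
    (a a' : A) (c : ℂ) :
    blockCumulant φ (Function.update X k (a + c • a')) B =
      blockCumulant φ (Function.update X k a) B +
        c * blockCumulant φ (Function.update X k a') B := by
  induction B using Finset.strongInduction with
  | H B ih =>
  have hBn : B.Nonempty := ⟨k, hk⟩
  have hB : B ≠ ⊥ := hBn.ne_empty
  -- In each term exactly one part contains `k`, and it is smaller than `B`: the recursion is affine
  -- in its cumulant, so linearity follows by induction.
  have key : ∀ u, blockCumulant φ (Function.update X k u) B =
      φ (oprod (Function.update X k u) B) -
        ∑ σ ∈ (ncPartitions B).erase (Finpartition.indiscrete hB),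
          blockCumulant φ (Function.update X k u) (σ.part k) *
            ∏ D ∈ σ.parts.erase (σ.part k), blockCumulant φ X D := by
    intro u
    rw [moment_eq_sum_blockCumulant φ _ hBn, sum_ncPartitions hB, eq_sub_iff_add_eq]
    congr 1
    refine Finset.sum_congr rfl fun σ hσ => ?_
    rw [← Finset.mul_prod_erase _ _ (σ.part_mem.2 hk)]
    congr 1
    refine Finset.prod_congr rfl fun D hD => ?_
    rw [Finset.mem_erase] at hD
    rw [blockCumulant_update_of_notMem]
    exact fun h => hD.1 (σ.part_eq_of_mem hD.2 h).symm
  obtain ⟨u, v, huv⟩ := oprod_update X hk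
  rw [key, key a, key a', huv, huv, huv, mul_sub, Finset.mul_sum]
  have h2 : ∀ σ ∈ (ncPartitions B).erase (Finpartition.indiscrete hB),
      blockCumulant φ (Function.update X k (a + c • a')) (σ.part k) *
          ∏ D ∈ σ.parts.erase (σ.part k), blockCumulant φ X D =
        blockCumulant φ (Function.update X k a) (σ.part k) *
          ∏ D ∈ σ.parts.erase (σ.part k), blockCumulant φ X D +
        c * (blockCumulant φ (Function.update X k a') (σ.part k) *
          ∏ D ∈ σ.parts.erase (σ.part k), blockCumulant φ X D) := by
    intro σ hσ
    rw [ih _ (ssubset_of_ne_indiscrete hB (Finset.ne_of_mem_erase hσ) (σ.part_mem.2 hk))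
      (σ.mem_part hk)]
    ring
  rw [Finset.sum_congr rfl h2, Finset.sum_add_distrib, mul_add, add_mul, mul_smul_comm,
    smul_mul_assoc, map_add, map_smul, smul_eq_mul]
  ring

/-- The free cumulant as a multilinear map. -/
noncomputable def cumulantMultilinear (n : ℕ) : MultilinearMap ℂ (fun _ : Fin n => A) ℂ :=
  MultilinearMap.mk' (fun X => freeCumulant φ n X)
    (fun X k a a' => by
      simpa [blockCumulant_univ] using
        blockCumulant_update φ X (Finset.mem_univ k) a a' 1)
    (fun X k c a => by
      -- This instance reads `κ = κ + κ`: a cumulant with a zero entry vanishes, which turns the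
      -- combined formula into homogeneity.
      have h0 := blockCumulant_update φ X (Finset.mem_univ k) 0 0 1
      have h1 := blockCumulant_update φ X (Finset.mem_univ k) 0 a c
      simp only [blockCumulant_univ, smul_zero, add_zero, one_mul, left_eq_add, zero_add,
        smul_eq_mul] at h0 h1 ⊢
      rw [h1, h0, zero_add])

@[simp] theorem cumulantMultilinear_apply (X : Fin n → A) :
    cumulantMultilinear φ n X = freeCumulant φ n X := rfl

end Recursion

/-! ### The genus bound by linear algebra -/

section Genus

variable {P : Type*}

/-- The operator `v ↦ v ∘ σ - v`. -/
def permDiff (σ : P → P) : (P → ℚ) →ₗ[ℚ] (P → ℚ) := LinearMap.funLeft ℚ ℚ σ - LinearMap.id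

@[simp] theorem permDiff_apply (σ : P → P) (v : P → ℚ) (p : P) :
    permDiff σ v p = v (σ p) - v p := rfl

variable [Fintype P]

theorem card_le_finrank_ker_permDiff {Q : Type*} [Fintype Q] (σ : P → P) (f : P → Q)
    (hf : Function.Surjective f) (hσ : ∀ p, f (σ p) = f p) :
    Fintype.card Q ≤ Module.finrank ℚ (LinearMap.ker (permDiff σ)) := by
  let g : (Q → ℚ) →ₗ[ℚ] LinearMap.ker (permDiff σ) :=
    (LinearMap.funLeft ℚ ℚ f).codRestrict _ (by
      intro v
      rw [LinearMap.mem_ker]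
      funext p
      simp [LinearMap.funLeft_apply, hσ])
  have hg : Function.Injective g := by
    intro v w h
    exact LinearMap.funLeft_injective_of_surjective ℚ ℚ f hf (congrArg Subtype.val h)
  simpa using LinearMap.finrank_le_finrank_of_injective hg

/-- For an involution, `v ∘ π - v` changes sign under `π`, so its values at one point of each pair
determine it. -/
theorem finrank_range_permDiff_le [LinearOrder P] (π : P → P) (hπ : ∀ p, π (π p) = p) :
    Module.finrank ℚ (LinearMap.range (permDiff π)) ≤
      (Finset.univ.filter fun p => p < π p).card := by
  let g : LinearMap.range (permDiff π) →ₗ[ℚ] ({p // p < π p} → ℚ) :=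
    (LinearMap.funLeft ℚ ℚ Subtype.val).comp (Submodule.subtype _)
  have hg : Function.Injective g := by
    rw [injective_iff_map_eq_zero]
    rintro ⟨w, v, rfl⟩ hw
    have h0 : ∀ p, p < π p → permDiff π v p = 0 := fun p hp => congrFun hw ⟨p, hp⟩
    apply Subtype.ext
    funext p
    change permDiff π v p = 0
    rcases lt_trichotomy p (π p) with h | h | h
    · exact h0 p h
    · simp [← h]
    · have := h0 (π p) (by rwa [hπ])
      rw [permDiff_apply, hπ] at this
      rw [permDiff_apply]
      linarith
  have := LinearMap.finrank_le_finrank_of_injective hg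
  rwa [Module.finrank_fintype_fun_eq_card, Fintype.card_subtype] at this

variable {r : ℕ} {b : P → Fin r} {γ : Equiv.Perm P} {π : P → P}

/-- Stability under `γ` spreads `T` over whole blocks; stability under `π` makes the set of blocks
where `T` holds closed, hence everything by connectedness. -/
theorem IsConnectedOn.induction_on (hγ : ∀ p q, b p = b q → γ.SameCycle p q)
    (hc : IsConnectedOn b π Finset.univ) (T : P → Prop) {p₀ : P} (h0 : T p₀)
    (hT : ∀ p, T p → T (γ p)) (hT' : ∀ p, T p → T (π p)) (p : P) : T p := by
  classical
  have hfib : ∀ p q, b q = b p → T p → T q := by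
    intro p q hpq hp
    obtain ⟨n, hn⟩ := (hγ p q hpq.symm).exists_nat_pow_eq
    rw [← hn]
    clear hn
    induction n with
    | zero => exact hp
    | succ n ih => rw [pow_succ']; exact hT _ ih
  have h := hc (Finset.univ.filter fun k => ∀ p, b p = k → T p) (Finset.subset_univ _)
    ⟨b p₀, by simpa using fun q hq => hfib p₀ q hq h0⟩ ?_
  · have h1 := Finset.mem_univ (b p)
    rw [← h] at h1
    simpa using (Finset.mem_filter.1 h1).2 p
  · intro q hq
    simp only [Finset.mem_filter, Finset.mem_univ, true_and] at hq ⊢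
    intro s hs
    exact hfib (π q) s hs (hT' q (hq q rfl))

/-- The genus bound: the permutation `π γ` has at most `m + 2 - r` cycles, if `γ` has `r` cycles
that are connected by the `m` transpositions of the involution `π`. -/
theorem card_cycles_add_le [LinearOrder P] (hr : 0 < r) (hb : Function.Surjective b)
    (hbγ : ∀ p, b (γ p) = b p) (hγ : ∀ p q, b p = b q → γ.SameCycle p q)
    (hπ : ∀ p, π (π p) = p) (hc : IsConnectedOn b π Finset.univ) (σ : Equiv.Perm P)
    (hσ : ∀ p, σ p = π (γ p)) [Fintype (Quotient (Equiv.Perm.SameCycle.setoid σ))] :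
    Fintype.card (Quotient (Equiv.Perm.SameCycle.setoid σ)) + r ≤
      (Finset.univ.filter fun p => p < π p).card + 2 := by
  classical
  obtain ⟨p₀, -⟩ := hb ⟨0, hr⟩
  -- The count is `c ≤ dim ker ≤ dim (I ⊓ J) + 1 = dim I + dim J - dim (I ⊔ J) + 1`, with `dim I ≤
  -- m`, `dim J ≤ |P| - r` and, by connectedness, `dim (I ⊔ J) ≥ |P| - 1`.
  set I := LinearMap.range (permDiff π)
  set J := LinearMap.range (permDiff γ.symm)
  have h1 : Fintype.card (Quotient (Equiv.Perm.SameCycle.setoid σ)) ≤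
      Module.finrank ℚ (LinearMap.ker (permDiff σ)) := by
    refine card_le_finrank_ker_permDiff σ (Quotient.mk _) Quotient.mk_surjective fun p => ?_
    exact Quotient.sound (s := Equiv.Perm.SameCycle.setoid σ)
      (Equiv.Perm.sameCycle_apply_left.2 (Equiv.Perm.SameCycle.refl σ p))
  have h2 : Module.finrank ℚ J + r ≤ Fintype.card P := by
    have h := card_le_finrank_ker_permDiff γ.symm b hb fun p => by
      rw [← hbγ, Equiv.apply_symm_apply]
    have h' := LinearMap.finrank_range_add_finrank_ker (permDiff γ.symm)
    simp only [Module.finrank_fintype_fun_eq_card, Fintype.card_fin] at h h'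
    change Module.finrank ℚ J + _ = _ at h'
    omega
  have h3 : Module.finrank ℚ I ≤ _ := finrank_range_permDiff_le π hπ
  have h4 : Fintype.card P ≤ Module.finrank ℚ (I ⊔ J : Submodule ℚ (P → ℚ)) + 1 := by
    have key : ∀ p, (Pi.single p 1 - Pi.single p₀ 1 : P → ℚ) ∈ I ⊔ J := by
      refine IsConnectedOn.induction_on hγ hc
        (fun p => (Pi.single p 1 - Pi.single p₀ 1 : P → ℚ) ∈ I ⊔ J) (p₀ := p₀) (by simp) ?_ ?_
      · intro p hp
        have : (Pi.single (γ p) 1 - Pi.single p 1 : P → ℚ) ∈ I ⊔ J := by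
          refine Submodule.mem_sup_right ⟨Pi.single p 1, ?_⟩
          funext q
          simp [Pi.single_apply, Equiv.symm_apply_eq]
        simpa using add_mem this hp
      · intro p hp
        have : (Pi.single (π p) 1 - Pi.single p 1 : P → ℚ) ∈ I ⊔ J := by
          refine Submodule.mem_sup_left ⟨Pi.single p 1, ?_⟩
          funext q
          have : π q = p ↔ q = π p := ⟨fun h => by rw [← h, hπ], fun h => by rw [h, hπ]⟩
          simp [Pi.single_apply, this]
        simpa using add_mem this hp
    have htop : (I ⊔ J) ⊔ Submodule.span ℚ {(Pi.single p₀ 1 : P → ℚ)} = ⊤ := by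
      rw [eq_top_iff, ← (Pi.basisFun ℚ P).span_eq, Submodule.span_le]
      rintro _ ⟨p, rfl⟩
      have := add_mem (Submodule.mem_sup_left (key p) :
        _ ∈ (I ⊔ J) ⊔ Submodule.span ℚ {(Pi.single p₀ 1 : P → ℚ)})
        (Submodule.mem_sup_right (Submodule.mem_span_singleton_self (Pi.single p₀ 1 : P → ℚ)))
      simpa using this
    have := Submodule.finrank_add_le_finrank_add_finrank (I ⊔ J)
      (Submodule.span ℚ {(Pi.single p₀ 1 : P → ℚ)})
    rw [htop, finrank_top, Module.finrank_fintype_fun_eq_card] at this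
    exact this.trans (by gcongr; exact (finrank_span_le_card _).trans (by simp))
  have h5 : Module.finrank ℚ (LinearMap.ker (permDiff σ)) ≤
      Module.finrank ℚ (I ⊓ J : Submodule ℚ (P → ℚ)) + 1 := by
    -- Invariance under `σ = π γ` means `v ∘ π = v ∘ γ⁻¹`, so one vector is a difference for both
    -- maps.
    have hmem : ∀ v ∈ LinearMap.ker (permDiff σ), permDiff π v ∈ I ⊓ J := by
      intro v hv
      refine ⟨⟨v, rfl⟩, v, ?_⟩
      funext p
      have := congrFun (LinearMap.mem_ker.1 hv) (γ.symm p)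
      simp only [permDiff_apply, hσ, Equiv.apply_symm_apply, Pi.zero_apply] at this ⊢
      linarith
    let g : LinearMap.ker (permDiff σ) →ₗ[ℚ] (I ⊓ J : Submodule ℚ (P → ℚ)) :=
      ((permDiff π).comp (Submodule.subtype _)).codRestrict _ fun v => hmem v.1 v.2
    have hg := LinearMap.finrank_range_add_finrank_ker g
    have hr' : Module.finrank ℚ (LinearMap.range g) ≤ _ := Submodule.finrank_le _
    have hk : Module.finrank ℚ (LinearMap.ker g) ≤ 1 := by
      -- Elements of this kernel are invariant under both `π` and `γ`, hence constant; their value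
      -- at `p₀` determines them.
      let ev : LinearMap.ker g →ₗ[ℚ] ℚ :=
        (LinearMap.proj p₀ : (P → ℚ) →ₗ[ℚ] ℚ).comp
          ((Submodule.subtype _).comp (Submodule.subtype _))
      have hev : Function.Injective ev := by
        rw [injective_iff_map_eq_zero]
        rintro ⟨⟨v, hv⟩, hgv⟩ h0
        change v p₀ = 0 at h0
        have hπv : ∀ p, v (π p) = v p := by
          intro p
          have := congrFun (congrArg Subtype.val (LinearMap.mem_ker.1 hgv)) p
          exact sub_eq_zero.1 this
        have hσv : ∀ p, v (γ p) = v p := by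
          intro p
          have := congrFun (LinearMap.mem_ker.1 hv) p
          rw [permDiff_apply, hσ, hπv] at this
          exact sub_eq_zero.1 this
        apply Subtype.ext
        apply Subtype.ext
        funext p
        exact IsConnectedOn.induction_on hγ hc (fun p => v p = 0) h0
          (fun p hp => by rw [hσv, hp]) (fun p hp => by rw [hπv, hp]) p
      simpa using LinearMap.finrank_le_finrank_of_injective hev
    omega
  have h6 := Submodule.finrank_sup_add_finrank_inf_eq I J
  omega

end Genus

/-! ### Traces of products and contractions along permutations -/

section Trace

/-- The entries of a product of matrices. -/
theorem list_ofFn_prod_apply {α R : Type*} [Fintype α] [DecidableEq α] [Ring R] (n : ℕ)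
    (B : Fin (n + 1) → Matrix α α R) (i j : α) :
    (List.ofFn B).prod i j = ∑ y : Fin n → α,
      (List.ofFn fun k => B k ((Fin.cons i y : Fin (n + 1) → α) k)
        ((Fin.snoc y j : Fin (n + 1) → α) k)).prod := by
  induction n generalizing i with
  | zero => simp [Fin.snoc]
  | succ n ih =>
    rw [List.ofFn_succ, List.prod_cons, Matrix.mul_apply]
    rw [← (Fin.consEquiv fun _ : Fin (n + 1) => α).sum_comp, Fintype.sum_prod_type]
    refine Finset.sum_congr rfl fun m _ => ?_
    rw [ih, Finset.mul_sum]
    refine Finset.sum_congr rfl fun y _ => ?_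
    rw [List.ofFn_succ (n := n + 1), List.prod_cons]
    have h : (Fin.snoc ((Fin.consEquiv fun _ : Fin (n + 1) => α) (m, y)) j : Fin (n + 2) → α) =
        Fin.cons m (Fin.snoc y j : Fin (n + 1) → α) :=
      (Fin.cons_snoc_eq_snoc_cons m y j).symm
    simp only [h, Fin.consEquiv_apply, Fin.cons_zero, Fin.cons_succ]

theorem trace_list_ofFn_prod {α R : Type*} [Fintype α] [DecidableEq α] [Ring R] (n : ℕ)
    (B : Fin (n + 1) → Matrix α α R) :
    (List.ofFn B).prod.trace = ∑ y : Fin (n + 1) → α,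
      (List.ofFn fun k => B k (y k) (y (k + 1))).prod := by
  simp only [Matrix.trace, Matrix.diag, list_ofFn_prod_apply]
  rw [← (Fin.consEquiv fun _ : Fin (n + 1) => α).sum_comp, Fintype.sum_prod_type]
  refine Finset.sum_congr rfl fun i _ => Finset.sum_congr rfl fun y _ => ?_
  congr 2
  funext k
  congr 1
  refine Fin.lastCases ?_ (fun k => ?_) k
  · simp
  · simp [Fin.snoc_castSucc, Fin.coeSucc_eq_succ]

variable {P : Type*} [Fintype P]

theorem exists_cycle_equiv (σ : Equiv.Perm P) (q : Quotient (Equiv.Perm.SameCycle.setoid σ)) :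
    ∃ (n : ℕ) (e : Fin (n + 1) ≃ {p // Quotient.mk (Equiv.Perm.SameCycle.setoid σ) p = q}),
      ∀ k, (e (k + 1) : P) = σ (e k) := by
  classical
  obtain ⟨p₀, rfl⟩ := Quotient.exists_rep q
  have hper : 0 < Function.minimalPeriod σ p₀ :=
    Function.minimalPeriod_pos_of_mem_periodicPts
      ((Function.Injective.mem_periodicPts σ.injective) p₀)
  obtain ⟨n, hn⟩ : ∃ n, Function.minimalPeriod σ p₀ = n + 1 := ⟨_, (Nat.succ_pred_eq_of_pos hper).symm⟩
  -- The cycle is enumerated by iterating from `p₀`; its length is the minimal period, so addition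
  -- in `Fin (n + 1)` wraps around as `σ` does.
  let f : Fin (n + 1) → {p // Quotient.mk (Equiv.Perm.SameCycle.setoid σ) p = ⟦p₀⟧} := fun k =>
    ⟨σ^[k] p₀, Quotient.sound (s := Equiv.Perm.SameCycle.setoid σ) (by
      change σ.SameCycle _ _
      rw [← Equiv.Perm.coe_pow]
      exact Equiv.Perm.sameCycle_pow_left.2 (Equiv.Perm.SameCycle.refl σ p₀))⟩
  have hf : Function.Bijective f := by
    constructor
    · intro j k hjk
      have := Function.iterate_injOn_Iio_minimalPeriod (f := σ) (x := p₀)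
        (by rw [Set.mem_Iio, hn]; exact j.2) (by rw [Set.mem_Iio, hn]; exact k.2)
        (congrArg Subtype.val hjk)
      exact Fin.ext this
    · rintro ⟨p, hp⟩
      have hp' : σ.SameCycle p₀ p := (Quotient.exact hp).symm
      obtain ⟨i, hi⟩ := hp'.exists_nat_pow_eq
      refine ⟨⟨i % (n + 1), Nat.mod_lt _ (Nat.succ_pos n)⟩, Subtype.ext ?_⟩
      change σ^[i % (n + 1)] p₀ = p
      rw [← hn, Function.iterate_mod_minimalPeriod_eq, ← Equiv.Perm.coe_pow, hi]
  refine ⟨n, Equiv.ofBijective f hf, fun k => ?_⟩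
  change σ^[(k + 1 : Fin (n + 1))] p₀ = σ (σ^[k] p₀)
  rw [← Function.iterate_succ_apply' σ, Fin.val_add_one]
  split_ifs with h
  · rw [h]
    simp [← hn, Function.iterate_minimalPeriod]
  · rfl

variable [DecidableEq P]

/-- The contraction of matrices along a permutation. -/
def permTrace {α : Type*} [Fintype α] (σ : Equiv.Perm P)
    (a : P → Matrix α α ℂ) : ℂ :=
  ∑ y : P → α, ∏ p, a p (y p) (y (σ p))

/-- The index sum factors over the cycles, each giving the trace of a word. The words are chosen
before `N`, so the limit distribution applies to them. -/
theorem exists_permTrace_eq (σ : Equiv.Perm P)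
    [Fintype (Quotient (Equiv.Perm.SameCycle.setoid σ))] :
    ∃ (n : Quotient (Equiv.Perm.SameCycle.setoid σ) → ℕ) (w : ∀ q, Fin (n q) → P),
      ∀ (N : ℕ) (a : P → Matrix (Fin N) (Fin N) ℂ),
        permTrace σ a = ∏ q, (List.ofFn fun j => a (w q j)).prod.trace := by
  classical
  choose n e he using exists_cycle_equiv σ
  refine ⟨fun q => n q + 1, fun q j => e q j, fun N a => ?_⟩
  have h1 : ∀ q, (List.ofFn fun j => a (e q j)).prod.trace =
      ∑ y : {p // Quotient.mk (Equiv.Perm.SameCycle.setoid σ) p = q} → Fin N,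
        ∏ k, a (e q k) (y (e q k)) (y (e q (k + 1))) := by
    intro q
    rw [trace_list_ofFn_prod, ← (Equiv.arrowCongr (e q) (Equiv.refl (Fin N))).symm.sum_comp]
    refine Finset.sum_congr rfl fun y _ => ?_
    rw [List.prod_ofFn]
    rfl
  rw [Finset.prod_congr rfl fun q _ => h1 q, Finset.prod_univ_sum, Fintype.piFinset_univ,
    permTrace]
  let E : (P → Fin N) ≃
      (∀ q, {p // Quotient.mk (Equiv.Perm.SameCycle.setoid σ) p = q} → Fin N) :=
    { toFun := fun y q p => y p
      invFun := fun y p => y _ ⟨p, rfl⟩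
      left_inv := fun y => rfl
      right_inv := fun y => by
        funext q ⟨p, hp⟩
        subst hp
        rfl }
  rw [← E.sum_comp]
  refine Finset.sum_congr rfl fun y _ => ?_
  rw [← (Equiv.sigmaFiberEquiv (Quotient.mk (Equiv.Perm.SameCycle.setoid σ))).prod_comp,
    Fintype.prod_sigma]
  refine Finset.prod_congr rfl fun q _ => ?_
  rw [← (e q).prod_comp]
  refine Finset.prod_congr rfl fun k _ => ?_
  change a (e q k) (y (e q k)) (y (σ (e q k))) = a (e q k) (y (e q k)) (y (e q (k + 1)))
  rw [he]

theorem HasLimitDistribution.permTrace_isBigO {a : P → ∀ N : ℕ, Matrix (Fin N) (Fin N) ℂ}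
    (ha : HasLimitDistribution a) (σ : Equiv.Perm P)
    [Fintype (Quotient (Equiv.Perm.SameCycle.setoid σ))] :
    (fun N => permTrace σ fun p => a p N) =O[atTop]
      fun N : ℕ => (N : ℝ) ^ Fintype.card (Quotient (Equiv.Perm.SameCycle.setoid σ)) := by
  obtain ⟨n, w, h⟩ := exists_permTrace_eq σ
  simp only [h]
  have h1 : ∀ q, (fun N : ℕ => (List.ofFn fun j => a (w q j) N).prod.trace) =O[atTop]
      fun N : ℕ => (N : ℝ) := by
    intro q
    obtain ⟨c, hc⟩ := ha (n q) (w q)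
    have h2 := (hc.isBigO_one ℝ).mul
      (isBigO_refl (fun N : ℕ => (N : ℂ)) atTop).norm_right
    refine (h2.congr' ?_ ?_)
    -- The normalization can be undone only for `N ≠ 0`.
    · filter_upwards [eventually_gt_atTop 0] with N hN
      have : (N : ℂ) ≠ 0 := by exact_mod_cast hN.ne'
      field_simp
    · filter_upwards with N
      simp
  have h3 := IsBigO.finsetProd (s := Finset.univ) fun q _ => h1 q
  simpa using h3

end Trace

/-! ### Wick formula and pair weights for matrix entries -/

section Ensemble

variable {A E : Type*} [CStarAlgebra A] [NormedAddCommGroup E] [InnerProductSpace ℂ E]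
  {φ : A →ₗ[ℂ] ℂ} {S : ∀ N : ℕ, E → Matrix (Fin N) (Fin N) A}

/-- The free family only has the entries with `i ≤ j`; those below the diagonal are adjoints of
them, combinations of the same parts with coefficient `-I`. -/
theorem IsSemicircularEnsemble.entry_mem_span (hS : IsSemicircularEnsemble φ S) (N : ℕ)
    (s : Set E) (g : s) (i j : Fin N) :
    S N g i j ∈ Submodule.span ℂ (Set.range
      (fun q : s × {p : Fin N × Fin N // p.1 ≤ p.2} × Bool =>
        reIm q.2.2 (S N (q.1 : E) q.2.1.1.1 q.2.1.1.2))) := by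
  have key : ∀ i j : Fin N, i ≤ j → ∀ c : ℂ, ((ℜ (S N g i j) : A) + c • (ℑ (S N g i j) : A)) ∈
      Submodule.span ℂ (Set.range
        (fun q : s × {p : Fin N × Fin N // p.1 ≤ p.2} × Bool =>
          reIm q.2.2 (S N (q.1 : E) q.2.1.1.1 q.2.1.1.2))) := by
    intro i j hij c
    exact add_mem (Submodule.subset_span ⟨(g, ⟨(i, j), hij⟩, true), by simp [reIm]⟩)
      (Submodule.smul_mem _ _ (Submodule.subset_span ⟨(g, ⟨(i, j), hij⟩, false), by simp [reIm]⟩))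
  rcases le_total i j with hij | hij
  · have := key i j hij Complex.I
    rwa [realPart_add_I_smul_imaginaryPart] at this
  · have h1 : S N g i j = star (S N g j i) := by
      conv_lhs => rw [← hS.selfAdjoint N g]
      rfl
    have h2 : star (S N g j i) = (ℜ (S N g j i) : A) + (-Complex.I) • (ℑ (S N g j i) : A) := by
      conv_lhs => rw [← realPart_add_I_smul_imaginaryPart (S N g j i)]
      rw [star_add, star_smul, (ℜ (S N g j i)).2.star_eq, (ℑ (S N g j i)).2.star_eq]
      simp
    rw [h1, h2]
    exact key j i hij _

/-- The Wick formula for the entries of a semicircular ensemble over an orthonormal family. -/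
theorem IsSemicircularEnsemble.moment_eq_sum_pairings (hφ : φ 1 = 1)
    (hS : IsSemicircularEnsemble φ S) {ι : Type*} {f : ι → E} (hf : Orthonormal ℂ f) (N : ℕ)
    {P : Type*} [LinearOrder P] [Fintype P] (i : P → ι) (x y : P → Fin N) (Q : Finset P) :
    φ (oprod (fun p => S N (f (i p)) (x p) (y p)) Q) =
      ∑ π ∈ ncPairings Q, pairWeight φ (fun p => S N (f (i p)) (x p) (y p)) π := by
  refine (hS.free N (Set.range f) ?_).moment_eq_sum_pairings hφ _ (fun p => ?_) Q
  · rintro _ ⟨j, rfl⟩ _ ⟨k, rfl⟩ hjk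
    exact hf.2 fun h => hjk (by rw [h])
  · exact hS.entry_mem_span N (Set.range f) ⟨f (i p), i p, rfl⟩ (x p) (y p)

/-- Each pair identifies the row index of either letter with the column index of its partner;
together these constraints say `x = y ∘ π`. -/
theorem IsSemicircularEnsemble.pairWeight_eq (hS : IsSemicircularEnsemble φ S) {ι : Type*}
    (f : ι → E) (N : ℕ) {P : Type*} [LinearOrder P] [Fintype P] (i : P → ι) (x y : P → Fin N)
    {π : P → P} (hπ : ∀ p, π (π p) = p) (hne : ∀ p, π p ≠ p) :
    pairWeight φ (fun p => S N (f (i p)) (x p) (y p)) π =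
      (N : ℂ)⁻¹ ^ (Finset.univ.filter fun p => p < π p).card *
        (∏ p with p < π p, inner ℂ (f (i p)) (f (i (π p)))) *
        if x = y ∘ π then 1 else 0 := by
  rw [← Finset.prod_const, ← Finset.prod_mul_distrib, Finset.prod_filter]
  simp only [pairWeight, hS.covariance]
  split_ifs with h
  · rw [mul_one]
    refine Finset.prod_congr rfl fun p _ => ?_
    subst h
    simp [hπ]
  · rw [mul_zero]
    obtain ⟨p, hp⟩ : ∃ p, x p ≠ y (π p) := by
      by_contra hc
      push Not at hc
      exact h (funext hc)
    rcases lt_or_gt_of_ne (hne p) with hlt | hlt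
    · refine Finset.prod_eq_zero (Finset.mem_univ (π p)) ?_
      rw [hπ, if_pos hlt, if_neg]
      exact fun hc => hp hc.2.symm
    · refine Finset.prod_eq_zero (Finset.mem_univ p) ?_
      rw [if_pos hlt, if_neg]
      exact fun hc => hp hc.1

end Ensemble

/-! ### Expanding the trace of an alternating product -/

section TraceExpansion

variable {A E : Type*} [CStarAlgebra A]

theorem trace_list_ofFn_prod_finRotate {α R : Type*} [Fintype α] [DecidableEq α] [Ring R] {n : ℕ}
    (hn : 0 < n) (B : Fin n → Matrix α α R) :
    (List.ofFn B).prod.trace = ∑ y : Fin n → α,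
      (List.ofFn fun k => B k (y k) (y (finRotate n k))).prod := by
  obtain ⟨n, rfl⟩ := Nat.exists_eq_succ_of_ne_zero hn.ne'
  simp only [Nat.succ_eq_add_one, trace_list_ofFn_prod, finRotate_apply]

theorem trace_altProd {N n : ℕ} (hn : 0 < n) (S : E → Matrix (Fin N) (Fin N) A) (f : Fin n → E)
    (a : Fin n → Matrix (Fin N) (Fin N) ℂ) :
    (altProd S f a).trace = ∑ u : (Fin n → Fin N) × (Fin n → Fin N),
      (∏ t, a t (u.2 t) (u.1 (finRotate n t))) •
        (List.ofFn fun t => S (f t) (u.1 t) (u.2 t)).prod := by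
  rw [altProd, trace_list_ofFn_prod_finRotate hn, Fintype.sum_prod_type]
  refine Finset.sum_congr rfl fun x _ => ?_
  have h1 : ∀ t, (S (f t) * constMatrix A (a t)) (x t) (x (finRotate n t)) =
      ∑ j, a t j (x (finRotate n t)) • S (f t) (x t) j := by
    intro t
    rw [Matrix.mul_apply]
    refine Finset.sum_congr rfl fun j _ => ?_
    rw [constMatrix, Matrix.map_apply, ← Algebra.commutes, Algebra.smul_def]
  simp only [h1]
  have h2 := (MultilinearMap.mkPiAlgebraFin ℂ n A).map_sum
    (fun t j => a t j (x (finRotate n t)) • S (f t) (x t) j)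
  simp only [MultilinearMap.map_smul_univ, MultilinearMap.mkPiAlgebraFin_apply] at h2
  exact h2

end TraceExpansion

/-! ### Letters of the words and their cyclic rotation -/

section Letters

variable {r : ℕ} (l : Fin r → ℕ)

/-- The positions of the letters, ordered lexicographically. -/
abbrev Letter := Σₗ k : Fin r, Fin (l k)

/-- The block of a letter. -/
def Letter.block (p : Letter l) : Fin r := (ofLex p).1

theorem Letter.block_monotone : Monotone (Letter.block l) := by
  intro p q h
  rcases Sigma.Lex.le_def.1 h with h | ⟨h, -⟩
  · exact h.le
  · exact h.le

theorem oprod_block {A : Type*} [Monoid A] (z : Letter l → A) (k : Fin r) :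
    oprod z {p | Letter.block l p = k} =
      (List.ofFn fun t : Fin (l k) => z (toLex ⟨k, t⟩)).prod := by
  have hsort : (Finset.univ.filter fun p => Letter.block l p = k).sort =
      List.ofFn fun t : Fin (l k) => (toLex ⟨k, t⟩ : Letter l) := by
    have hinj : Function.Injective fun t : Fin (l k) => (toLex ⟨k, t⟩ : Letter l) := by
      intro s t h
      simpa using h
    refine List.Perm.eq_of_pairwise' (r := (· ≤ ·)) (Finset.pairwise_sort _ _) ?_ ?_
    · rw [List.pairwise_ofFn]
      intro s t hst
      exact Sigma.Lex.le_def.2 (Or.inr ⟨rfl, hst.le⟩)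
    · refine (List.perm_ext_iff_of_nodup (Finset.sort_nodup _ _) (List.nodup_ofFn.2 hinj)).2 ?_
      intro p
      simp only [Finset.mem_sort, Finset.mem_filter, Finset.mem_univ, true_and, List.mem_ofFn]
      constructor
      · rintro rfl
        exact ⟨(ofLex p).2, rfl⟩
      · rintro ⟨t, rfl⟩
        rfl
  rw [oprod, hsort, List.map_ofFn]
  rfl

/-- The cyclic rotation of the letters of each block. -/
def Letter.rotate : Equiv.Perm (Letter l) :=
  (ofLex.trans (Equiv.sigmaCongrRight fun k => finRotate (l k))).trans toLex

theorem finRotate_sameCycle {n : ℕ} (i j : Fin n) : (finRotate n).SameCycle i j := by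
  rcases n with _ | n
  · exact i.elim0
  have h : ∀ i : Fin (n + 1), (finRotate (n + 1)).SameCycle 0 i := by
    intro i
    induction i using Fin.induction with
    | zero => exact Equiv.Perm.SameCycle.refl _ _
    | succ i ih =>
      have := Equiv.Perm.sameCycle_apply_right.2 ih
      rwa [finRotate_apply, Fin.coeSucc_eq_succ] at this
  exact (h i).symm.trans (h j)

theorem Letter.rotate_sameCycle (p q : Letter l) (h : Letter.block l p = Letter.block l q) :
    (Letter.rotate l).SameCycle p q := by
  obtain ⟨k, s⟩ := p
  obtain ⟨k', t⟩ := q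
  obtain rfl : k = k' := h
  obtain ⟨m, hm⟩ := (finRotate_sameCycle s t).exists_nat_pow_eq
  refine ⟨m, ?_⟩
  rw [zpow_natCast, ← hm]
  clear hm
  induction m with
  | zero => rfl
  | succ m ih => rw [pow_succ', pow_succ']; exact congrArg (Letter.rotate l) ih

/-- Pairs of index functions on all letters, block by block. -/
def letterIndexEquiv (α : Type*) : ((Letter l → α) × (Letter l → α)) ≃
    (∀ k, (Fin (l k) → α) × (Fin (l k) → α)) where
  toFun u k := (fun t => u.1 (toLex ⟨k, t⟩), fun t => u.2 (toLex ⟨k, t⟩))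
  invFun g := (fun p => (g (ofLex p).1).1 (ofLex p).2, fun p => (g (ofLex p).1).2 (ofLex p).2)
  left_inv _ := rfl
  right_inv _ := rfl

end Letters

/-! ### Genus expansion of the cumulants -/

section Expansion

variable {A E : Type*} [CStarAlgebra A] [NormedAddCommGroup E] [InnerProductSpace ℂ E]
  {φ : A →ₗ[ℂ] ℂ} {S : ∀ N : ℕ, E → Matrix (Fin N) (Fin N) A}

open Classical in
/-- The non-crossing pairings of the letters that connect all blocks. -/
noncomputable def connectedPairings {r : ℕ} (l : Fin r → ℕ) : Finset (Letter l → Letter l) :=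
  (ncPairings {p | Letter.block l p ∈ Finset.univ}).filter
    (fun π => IsConnectedOn (Letter.block l) π Finset.univ)

theorem mem_connectedPairings {r : ℕ} {l : Fin r → ℕ} {π : Letter l → Letter l} :
    π ∈ connectedPairings l ↔ IsNCPairing Finset.univ π ∧
      IsConnectedOn (Letter.block l) π Finset.univ := by
  simp [connectedPairings, mem_ncPairings]

/-- The genus expansion of the free cumulants of traces of alternating products. -/
theorem freeCumulant_trace_altProd (hφ : φ 1 = 1) (hS : IsSemicircularEnsemble φ S)
    {ι : Type*} {f : ι → E} (hf : Orthonormal ℂ f) {r : ℕ} (hr : 0 < r) (l : Fin r → ℕ)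
    (hl : ∀ k, 0 < l k) (i : ((k : Fin r) × Fin (l k)) → ι) (N : ℕ)
    (a : ((k : Fin r) × Fin (l k)) → Matrix (Fin N) (Fin N) ℂ) :
    freeCumulant φ r (fun k =>
        (altProd (S N) (fun t : Fin (l k) => f (i ⟨k, t⟩)) (fun t => a ⟨k, t⟩)).trace) =
      ∑ π ∈ (connectedPairings l).attach,
        (N : ℂ)⁻¹ ^ (Finset.univ.filter fun p => p < π.1 p).card *
          (∏ p with p < π.1 p, inner ℂ (f (i (ofLex p))) (f (i (ofLex (π.1 p))))) *
          permTrace ((Letter.rotate l).trans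
            (Function.Involutive.toPerm π.1 (mem_connectedPairings.1 π.2).1.invol))
            (fun p => a (ofLex p)) := by
  classical
  have h1 : ∀ k, (altProd (S N) (fun t : Fin (l k) => f (i ⟨k, t⟩)) (fun t => a ⟨k, t⟩)).trace = _ :=
    fun k => trace_altProd (hl k) _ _ _
  simp only [h1]
  -- Multilinearity pulls out the index sums and the constant coefficients, leaving cumulants of
  -- products of entries with fixed indices.
  rw [← cumulantMultilinear_apply, MultilinearMap.map_sum]
  simp only [MultilinearMap.map_smul_univ, cumulantMultilinear_apply, smul_eq_mul]
  rw [← (letterIndexEquiv l (Fin N)).sum_comp]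
  have h2 : ∀ u : (Letter l → Fin N) × (Letter l → Fin N),
      freeCumulant φ r (fun k => (List.ofFn fun t : Fin (l k) =>
        S N (f (i ⟨k, t⟩)) ((letterIndexEquiv l (Fin N) u k).1 t)
          ((letterIndexEquiv l (Fin N) u k).2 t)).prod) =
      ∑ π ∈ (connectedPairings l).attach,
        (N : ℂ)⁻¹ ^ (Finset.univ.filter fun p => p < π.1 p).card *
          (∏ p with p < π.1 p, inner ℂ (f (i (ofLex p))) (f (i (ofLex (π.1 p))))) *
          if u.1 = u.2 ∘ π.1 then 1 else 0 := by
    intro u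
    rw [← blockCumulant_univ]
    have h3 := blockCumulant_eq_clusterSum φ (Letter.block_monotone l)
      (fun p => S N (f (i (ofLex p))) (u.1 p) (u.2 p))
      (hS.moment_eq_sum_pairings hφ hf N (fun p : Letter l => i (ofLex p)) u.1 u.2) Finset.univ
      ⟨⟨0, hr⟩, Finset.mem_univ _⟩
    simp only [oprod_block] at h3
    refine h3.trans ((Finset.sum_attach (connectedPairings l) _).symm.trans ?_)
    refine Finset.sum_congr rfl fun π _ => ?_
    have hπ := (mem_connectedPairings.1 π.2).1
    exact hS.pairWeight_eq f N (fun p : Letter l => i (ofLex p)) u.1 u.2 hπ.invol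
      fun p => (hπ.supp p).2 (Finset.mem_univ p)
  have h4 : ∀ u : (Letter l → Fin N) × (Letter l → Fin N),
      ∏ k, ∏ t : Fin (l k), a ⟨k, t⟩ ((letterIndexEquiv l (Fin N) u k).2 t)
        ((letterIndexEquiv l (Fin N) u k).1 (finRotate (l k) t)) =
      ∏ p : Letter l, a (ofLex p) (u.2 p) (u.1 (Letter.rotate l p)) := by
    intro u
    rw [← Fintype.prod_sigma', ← toLex.prod_comp]
    rfl
  simp only [h2, h4, Finset.mul_sum]
  rw [Finset.sum_comm]
  refine Finset.sum_congr rfl fun π _ => ?_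
  rw [permTrace, Fintype.sum_prod_type_right, Finset.mul_sum]
  refine Finset.sum_congr rfl fun y _ => ?_
  -- The pairing determines the row indices from the column indices, so each constant matrix
  -- receives `y p` and `y (π (γ p))`: a contraction along `π γ`.
  rw [Finset.sum_eq_single (y ∘ π.1)]
  · simp only [if_true, mul_one]
    rw [mul_comm]
    rfl
  · intro x _ hx
    simp [hx]
  · intro h; exact absurd (Finset.mem_univ _) h

end Expansion

end FreeProb

/-! ### The limit theorem -/

theorem theorem3p4
    {A : Type*} [CStarAlgebra A] (φ : A →ₗ[ℂ] ℂ) (hφ : FreeProb.IsState φ)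
    {E : Type*} [NormedAddCommGroup E] [InnerProductSpace ℂ E] [CompleteSpace E]
    (S : ∀ N : ℕ, E → Matrix (Fin N) (Fin N) A) (hS : FreeProb.IsSemicircularEnsemble φ S)
    {ι : Type*} (f : ι → E) (hf : Orthonormal ℂ f)
    (r : ℕ) (hr : 3 ≤ r) (l : Fin r → ℕ) (hl : ∀ k, 0 < l k)
    (i : ((k : Fin r) × Fin (l k)) → ι)
    (a : ((k : Fin r) × Fin (l k)) → ∀ N : ℕ, Matrix (Fin N) (Fin N) ℂ)
    (ha : FreeProb.HasLimitDistribution a)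
    (Y : Fin r → ∀ N : ℕ, Matrix (Fin N) (Fin N) A)
    (hY : ∀ k N, Y k N =
      FreeProb.altProd (S N) (fun t : Fin (l k) => f (i ⟨k, t⟩)) (fun t => a ⟨k, t⟩ N)) :
    Tendsto (fun N : ℕ => FreeProb.freeCumulant φ r (fun k => (Y k N).trace)) atTop (𝓝 0) ∧
    (fun N : ℕ => FreeProb.freeCumulant φ r (fun k => (Y k N).trace)) =O[atTop]
      (fun N : ℕ => ((N : ℝ))⁻¹) := by
  classical
  have key : (fun N : ℕ => FreeProb.freeCumulant φ r (fun k => (Y k N).trace)) =O[atTop]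
      (fun N : ℕ => ((N : ℝ))⁻¹) := by
    simp only [hY]
    simp only [FreeProb.freeCumulant_trace_altProd hφ.map_one hS hf (by omega : 0 < r) l hl i _
      (fun p => a p _)]
    -- The set of pairings does not depend on `N`, so it suffices to bound each term.
    refine IsBigO.fun_sum fun π _ => ?_
    obtain ⟨hπ, hc⟩ := FreeProb.mem_connectedPairings.1 π.2
    set σ : Equiv.Perm (FreeProb.Letter l) := (FreeProb.Letter.rotate l).trans
      (Function.Involutive.toPerm π.1 hπ.invol)
    set m := (Finset.univ.filter fun p => p < π.1 p).card
    have hg := FreeProb.card_cycles_add_le (γ := FreeProb.Letter.rotate l) (by omega : 0 < r)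
      (fun k => ⟨toLex ⟨k, ⟨0, hl k⟩⟩, rfl⟩) (fun _ => rfl) (FreeProb.Letter.rotate_sameCycle l)
      hπ.invol hc σ (fun _ => rfl)
    have ha' : FreeProb.HasLimitDistribution
        (fun (p : FreeProb.Letter l) N => a (ofLex p) N) := fun n w => ha n fun j => ofLex (w j)
    have h1 := ha'.permTrace_isBigO σ
    have h2 : (fun N : ℕ => (N : ℂ)⁻¹ ^ m *
        ∏ p with p < π.1 p, inner ℂ (f (i (ofLex p))) (f (i (ofLex (π.1 p))))) =O[atTop]
        fun N : ℕ => (N : ℝ)⁻¹ ^ m := by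
      refine ((isBigO_refl (fun N : ℕ => (N : ℂ)⁻¹ ^ m) atTop).norm_right.mul
        (isBigO_const_one ℝ _ atTop)).congr_right fun N => ?_
      simp
    refine (h2.mul h1).trans (IsBigO.of_bound 1 ?_)
    filter_upwards [eventually_ge_atTop 1] with N hN
    have hN' : (1 : ℝ) ≤ N := by exact_mod_cast hN
    have hN0 : (0 : ℝ) < N := by linarith
    rw [one_mul, Real.norm_of_nonneg (by positivity), Real.norm_of_nonneg (by positivity), inv_pow,
      inv_mul_le_iff₀ (by positivity), ← div_eq_mul_inv, le_div_iff₀ hN0, ← pow_succ]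
    -- With `r ≥ 3`, the genus bound leaves at most `m - 1` cycles, so one factor `N⁻¹` remains.
    exact pow_le_pow_right₀ hN' (by change _ + r ≤ m + 2 at hg; omega)
  refine ⟨key.trans_tendsto ?_, key⟩
  exact tendsto_inv_atTop_zero.comp tendsto_natCast_atTop_atTop
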